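/- Let $m,n\ge 1$ and let $\Omega\subseteq\mathbb R^m$ be a domain (a non-empty connected open set). A convex body is a non-empty compact convex subset of $\mathbb R^n$, and $|\cdot|$ is Lebesgue measure on $\mathbb R^n$. For a convex body $K$ let $h_K(\xi)=\sup_{\zeta\in K}\zeta\cdot\xi$ be its support function. Let $(A_x)_{x\in\Omega}$ be a subharmonic family of convex bodies in $\mathbb R^n$. This means that $x\mapsto A_x$ is continuous on $\Omega$ for the Hausdorff metric and that, for all $x\in\Omega$ and $\varepsilon>0$ such that the closed ball $\overline{B_\varepsilon(x)}$ is contained in $\Omega$, $$A_x\supseteq\int_{\partial B_\varepsilon(x)}A_y\,dS(y),$$ where $dS$ is the normalized (total mass one) surface measure on $\partial B_\varepsilon(x)$, and the Minkowski integral on the right is the closed convex set with support function $\xi\mapsto\int_{\partial B_\varepsilon(x)}h_{A_y}(\xi)\,dS(y)$, that is, the set of all $\zeta\in\mathbb R^n$ with $\zeta\cdot\xi\le\int_{\partial B_\varepsilon(x)}h_{A_y}(\xi)\,dS(y)$ for every $\xi\in\mathbb R^n$. Assume that $|A_x|>0$ for at least one $x\in\Omega$. Then $x\mapsto|A_x|^{1/n}$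 is harmonic on $\Omega$ if and only if there are a convex body $B\subset\mathbb R^n$ and harmonic functions $c:\Omega\to(0,\infty)$ and $d:\Omega\to\mathbb R^n$ such that $A_x=c_xB+d_x$ for all $x\in\Omega$. -/

import Mathlib

open MeasureTheory Set InnerProductSpace
open scoped Pointwise

noncomputable section

/-- The support function `h_K(ξ) = sup_{ζ ∈ K} ζ · ξ` of a set `K ⊆ ℝⁿ`. -/
def supportFn {n : ℕ} (K : Set (EuclideanSpace ℝ (Fin n))) (ξ : EuclideanSpace ℝ (Fin n)) : ℝ :=
  sSup ((fun ζ => inner ℝ ζ ξ) '' K)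

/-- The set `A(h) = {ζ | ζ · ξ ≤ h(ξ) for all ξ}`. If `h` is convex and positively homogeneous,
this is the unique closed convex set whose support function is `h`. -/
def setOfSupportFn {n : ℕ} (h : EuclideanSpace ℝ (Fin n) → ℝ) : Set (EuclideanSpace ℝ (Fin n)) :=
  {ζ | ∀ ξ, inner ℝ ζ ξ ≤ h ξ}

/-- The Minkowski integral `∫_D A_y dμ(y) = A(∫_D h_{A_y} dμ(y))`. -/
def minkowskiIntegral {m n : ℕ} (D : Set (EuclideanSpace ℝ (Fin m)))
    (A : EuclideanSpace ℝ (Fin m) → ConvexBody (EuclideanSpace ℝ (Fin n)))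
    (μ : Measure (EuclideanSpace ℝ (Fin m))) : Set (EuclideanSpace ℝ (Fin n)) :=
  setOfSupportFn fun ξ => ∫ y in D, supportFn (A y : Set (EuclideanSpace ℝ (Fin n))) ξ ∂μ

/-- The normalized Euclidean surface measure on the sphere `∂B_ε(x)` in `ℝᵐ`: the normalized
surface measure of the unit sphere, transported by `u ↦ x + ε u`. -/
def normalizedSphereMeasure {m : ℕ} (x : EuclideanSpace ℝ (Fin m)) (ε : ℝ) :
    Measure (EuclideanSpace ℝ (Fin m)) :=
  Measure.map (fun u : Metric.sphere (0 : EuclideanSpace ℝ (Fin m)) 1 => x + ε • (u : EuclideanSpace ℝ (Fin m)))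
    (((volume : Measure (EuclideanSpace ℝ (Fin m))).toSphere univ)⁻¹ •
      (volume : Measure (EuclideanSpace ℝ (Fin m))).toSphere)

/-- A family `(A_x)` of convex bodies in `ℝⁿ` is subharmonic over `Ω ⊆ ℝᵐ` if it is continuous
on `Ω` for the Hausdorff metric and `A_x ⊇ ∫_{∂B_ε(x)} A_y dS(y)` for every ball
`B_ε(x)` that lies in `Ω` together with its boundary. Only the values of `A` on `Ω` matter. -/
structure IsSubharmonicFamily {m n : ℕ} (Ω : Set (EuclideanSpace ℝ (Fin m)))
    (A : EuclideanSpace ℝ (Fin m) → ConvexBody (EuclideanSpace ℝ (Fin n))) : Prop where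
  continuousOn : ContinuousOn A Ω
  integral_subset : ∀ x : EuclideanSpace ℝ (Fin m), ∀ ε : ℝ, 0 < ε →
    Metric.closedBall x ε ⊆ Ω →
      minkowskiIntegral (Metric.sphere x ε) A (normalizedSphereMeasure x ε) ⊆
        (A x : Set (EuclideanSpace ℝ (Fin n)))

end

/-! Write V(K) for the n-th root of the volume of K. If A_x = c_x B + d_x, then V(A_x) = c_x V(B), a
constant multiple of c, which settles one direction.

For the other, the inclusion A_x ⊇ ∫ A_y says that x ↦ h_{A_x}(ξ) has the super-mean-value property
for every ξ. Averaging the bodies A_{x-εy} + A_{x+εy} over y in the unit ball therefore gives a body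
inside 2 A_x. The Brunn–Minkowski inequality for Minkowski integrals (`integral_volumeRoot_le`)
bounds the mean of V(A_{x-εy} + A_{x+εy}) by 2 V(A_x). If V(A_x) is harmonic, this bound is the mean
of V(A_{x-εy}) + V(A_{x+εy}), which by Brunn–Minkowski is pointwise at most V(A_{x-εy} + A_{x+εy}).
So equality holds for every y (`IsSubharmonicFamily.volumeRoot_add_le`), and the equality case makes
antipodal bodies homothetic. Any point near x forms with x such a pair about their midpoint, so
connectedness of Ω makes all bodies homothetic. V(A_x) is positive throughout Ω by the minimum
principle, and it serves as c. For d, the mean D of d around x satisfies D·ξ ≤ d_x·ξ for all ξ,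
which forces D = d_x.

The equality case of Brunn–Minkowski is obtained by slicing and one-dimensional Prékopa–Leindler:
for normalized bodies, the marginals along each linear functional are translates of each other.
Comparing centroids shows that all these shifts come from one vector, and separating hyperplanes
then identify the bodies (`eq_translate_of_brunnMinkowski_eq`).

Means are taken against a smooth radial density on the unit ball (`ballMeasure`) instead of spheres.
Then smoothness follows by convolution, and the link with the Laplacian is an integration by parts
on the whole space. -/

/-! ### One-dimensional Prékopa–Leindler with its equality case. -/

/-- Strict Bernoulli, (P/Q)^l < 1 + l (P/Q - 1), multiplied by P^(1-l) Q^l. Strictness off the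
diagonal is what yields the equality case below. -/
theorem mul_rpow_weighted_gt {P Q l : ℝ} (hP : 0 < P) (hQ : 0 < Q) (hl : 0 < l) (hl1 : l < 1)
    (hne : P ≠ Q) : P < P ^ (1 - l) * Q ^ l * ((1 - l) + l * (P / Q)) := by
  have hx : 0 < P / Q := div_pos hP hQ
  have h := rpow_one_add_lt_one_add_mul_self (s := P / Q - 1) (by linarith)
    (by rw [sub_ne_zero]; intro h; exact hne ((div_eq_one_iff_eq hQ.ne').1 h)) hl hl1
  have e1 : 1 + (P / Q - 1) = P / Q := by ring
  rw [e1] at h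
  have e2 : P ^ (1 - l) * Q ^ l * (P / Q) ^ l = P := by
    rw [Real.div_rpow hP.le hQ.le, Real.rpow_sub hP, Real.rpow_one]
    have := (Real.rpow_pos_of_pos hP l).ne'
    have := (Real.rpow_pos_of_pos hQ l).ne'
    field_simp
  calc P = P ^ (1 - l) * Q ^ l * (P / Q) ^ l := e2.symm
    _ < _ := by
      apply mul_lt_mul_of_pos_left _ (by positivity)
      linarith

theorem mul_rpow_weighted_ge {P Q l : ℝ} (hP : 0 < P) (hQ : 0 < Q) (hl : 0 < l) (hl1 : l < 1) :
    P ≤ P ^ (1 - l) * Q ^ l * ((1 - l) + l * (P / Q)) := by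
  rcases eq_or_ne P Q with rfl | h
  · rw [div_self hP.ne', ← Real.rpow_add hP]; simp
  · exact (mul_rpow_weighted_gt hP hQ hl hl1 h).le

/-- The monotone transport between two positive continuous probability densities. -/
theorem exists_monotone_transport {p q : ℝ → ℝ} {a b a' b' : ℝ} (hab : a < b) (hab' : a' < b')
    (hp : ContinuousOn p (Ioo a b)) (hp0 : ∀ s ∈ Ioo a b, 0 < p s)
    (hpi : IntervalIntegrable p volume a b) (hp1 : ∫ s in a..b, p s = 1)
    (hq : ContinuousOn q (Ioo a' b')) (hq0 : ∀ s ∈ Ioo a' b', 0 < q s)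
    (hqi : IntervalIntegrable q volume a' b') (hq1 : ∫ s in a'..b', q s = 1) :
    ∃ T : ℝ → ℝ, StrictMonoOn T (Ioo a b) ∧ T '' Ioo a b = Ioo a' b' ∧
      ∀ s ∈ Ioo a b, HasDerivAt T (p s / q (T s)) s := by
  have key : ∀ {p : ℝ → ℝ} {a b : ℝ}, a < b → ContinuousOn p (Ioo a b) →
      (∀ s ∈ Ioo a b, 0 < p s) → IntervalIntegrable p volume a b → ∫ s in a..b, p s = 1 →
      ∃ F : ℝ → ℝ, StrictMonoOn F (Icc a b) ∧ F a = 0 ∧ F b = 1 ∧ ContinuousOn F (Icc a b) ∧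
        ∀ s ∈ Ioo a b, HasDerivAt F (p s) s := by
    intro p a b hab hp hp0 hpi hp1
    have hd : ∀ s ∈ Ioo a b, HasDerivAt (fun s => ∫ t in a..s, p t) (p s) s := by
      intro s hs
      have hi : IntervalIntegrable p volume a s :=
        hpi.mono_set (by rw [uIcc_of_le hs.1.le, uIcc_of_le hab.le]; exact Icc_subset_Icc_right hs.2.le)
      refine intervalIntegral.integral_hasDerivAt_right hi ?_
        (hp.continuousAt (Ioo_mem_nhds hs.1 hs.2))
      exact hp.stronglyMeasurableAtFilter isOpen_Ioo s hs
    have hc : ContinuousOn (fun s => ∫ t in a..s, p t) (Icc a b) := by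
      have := intervalIntegral.continuousOn_primitive_interval (μ := volume) (f := p) (a := a) (b := b)
        (by rw [← intervalIntegrable_iff'] ; exact hpi)
      rwa [uIcc_of_le hab.le] at this
    refine ⟨fun s => ∫ t in a..s, p t, ?_, by simp, hp1, hc, hd⟩
    refine strictMonoOn_of_deriv_pos (convex_Icc a b) hc ?_
    intro s hs
    rw [interior_Icc] at hs
    rw [(hd s hs).deriv]
    exact hp0 s hs
  obtain ⟨F, hFm, hFa, hFb, hFc, hFd⟩ := key hab hp hp0 hpi hp1
  obtain ⟨G, hGm, hGa, hGb, hGc, hGd⟩ := key hab' hq hq0 hqi hq1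
  have memI : ∀ {F : ℝ → ℝ} {a b : ℝ}, a < b → StrictMonoOn F (Icc a b) → F a = 0 → F b = 1 →
      ∀ s ∈ Ioo a b, F s ∈ Ioo (0:ℝ) 1 := by
    intro F a b hab hFm hFa hFb s hs
    exact ⟨hFa ▸ hFm (left_mem_Icc.2 hab.le) (Ioo_subset_Icc_self hs) hs.1,
      hFb ▸ hFm (Ioo_subset_Icc_self hs) (right_mem_Icc.2 hab.le) hs.2⟩
  have ivt : ∀ {F : ℝ → ℝ} {a b : ℝ}, a < b → ContinuousOn F (Icc a b) → F a = 0 → F b = 1 →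
      ∀ y ∈ Ioo (0:ℝ) 1, ∃ t ∈ Ioo a b, F t = y := by
    intro F a b hab hFc hFa hFb y hy
    have := intermediate_value_Ioo hab.le hFc
    rw [hFa, hFb] at this
    exact this hy
  -- T is G⁻¹ ∘ F for the two distribution functions; its values outside the interval are
  -- irrelevant.
  have hT : ∀ s, ∃ t, s ∈ Ioo a b → t ∈ Ioo a' b' ∧ G t = F s := by
    intro s
    by_cases hs : s ∈ Ioo a b
    · obtain ⟨t, ht, h⟩ := ivt hab' hGc hGa hGb _ (memI hab hFm hFa hFb s hs)
      exact ⟨t, fun _ => ⟨ht, h⟩⟩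
    · exact ⟨0, fun h => absurd h hs⟩
  choose T hT using hT
  have hTm : StrictMonoOn T (Ioo a b) := by
    intro s hs t ht hst
    have h1 := hT s hs
    have h2 := hT t ht
    rw [← hGm.lt_iff_lt (Ioo_subset_Icc_self h1.1) (Ioo_subset_Icc_self h2.1), h1.2, h2.2]
    exact hFm (Ioo_subset_Icc_self hs) (Ioo_subset_Icc_self ht) hst
  have hTi : T '' Ioo a b = Ioo a' b' := by
    apply Subset.antisymm
    · rintro _ ⟨s, hs, rfl⟩; exact (hT s hs).1
    · intro t ht
      obtain ⟨s, hs, h⟩ := ivt hab hFc hFa hFb _ (memI hab' hGm hGa hGb t ht)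
      refine ⟨s, hs, ?_⟩
      have h1 := hT s hs
      exact hGm.injOn (Ioo_subset_Icc_self h1.1) (Ioo_subset_Icc_self ht) (h1.2.trans h)
  refine ⟨T, hTm, hTi, ?_⟩
  intro s hs
  have hsn : Ioo a b ∈ nhds s := Ioo_mem_nhds hs.1 hs.2
  have hTs := (hT s hs).1
  -- A monotone map whose image is a neighbourhood has no jump.
  have hcont : ContinuousAt T s := hTm.continuousAt_of_image_mem_nhds hsn
    (by rw [hTi]; exact Ioo_mem_nhds hTs.1 hTs.2)
  have hslope := (hGd _ hTs)
  have hG0 := (hq0 _ hTs).ne'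
  -- differentiate `G ∘ T = F`
  rw [hasDerivAt_iff_tendsto_slope]
  have h1 := (hasDerivAt_iff_tendsto_slope.1 (hFd s hs))
  have h2 := (hasDerivAt_iff_tendsto_slope.1 hslope)
  have hTne : Filter.Tendsto T (nhdsWithin s {s}ᶜ) (nhdsWithin (T s) {T s}ᶜ) := by
    refine tendsto_nhdsWithin_iff.2 ⟨hcont.tendsto.mono_left nhdsWithin_le_nhds, ?_⟩
    filter_upwards [mem_nhdsWithin_of_mem_nhds hsn, self_mem_nhdsWithin] with t ht hts h
    exact hts (hTm.injOn ht hs h)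
  refine (h1.div (h2.comp hTne) hG0).congr' ?_
  filter_upwards [mem_nhdsWithin_of_mem_nhds hsn, self_mem_nhdsWithin] with t ht hts
  have hne : T t - T s ≠ 0 := sub_ne_zero.2 (fun h => hts (hTm.injOn ht hs h))
  have hne1 : t - s ≠ 0 := sub_ne_zero.2 hts
  have hne2 : F t - F s ≠ 0 := sub_ne_zero.2
    (fun h => hts (hFm.injOn (Ioo_subset_Icc_self ht) (Ioo_subset_Icc_self hs) h))
  simp only [Pi.div_apply, Function.comp, slope_def_field, (hT t ht).2, (hT s hs).2]
  field_simp

/-- One-dimensional Prékopa–Leindler inequality with its equality case, for densities which are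
positive and continuous on an interval. -/
theorem prekopa_leindler_Ioo {p q : ℝ → ℝ} {r : ℝ → ENNReal} {a b a' b' l : ℝ} (hl : 0 < l)
    (hl1 : l < 1) (hab : a < b) (hab' : a' < b')
    (hp : ContinuousOn p (Ioo a b)) (hp0 : ∀ s ∈ Ioo a b, 0 < p s)
    (hpi : IntervalIntegrable p volume a b) (hp1 : ∫ s in a..b, p s = 1)
    (hq : ContinuousOn q (Ioo a' b')) (hq0 : ∀ s ∈ Ioo a' b', 0 < q s)
    (hqi : IntervalIntegrable q volume a' b') (hq1 : ∫ s in a'..b', q s = 1)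
    (hr : ∀ s ∈ Ioo a b, ∀ t ∈ Ioo a' b',
      ENNReal.ofReal (p s ^ (1 - l) * q t ^ l) ≤ r ((1 - l) * s + l * t)) :
    1 ≤ ∫⁻ x, r x ∧ (∫⁻ x, r x ≤ 1 →
      ∃ c, a' = a + c ∧ b' = b + c ∧ ∀ s ∈ Ioo a b, q (s + c) = p s) := by
  obtain ⟨T, hTm, hTi, hTd⟩ := exists_monotone_transport hab hab' hp hp0 hpi hp1 hq hq0 hqi hq1
  have hTmem : ∀ s ∈ Ioo a b, T s ∈ Ioo a' b' := fun s hs => hTi ▸ mem_image_of_mem T hs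
  -- D(s) bounds from below the integrand r(z(s)) z'(s) after the substitution z(s) = (1-l) s + l
  -- T(s), because T' = p / (q ∘ T).
  set D : ℝ → ℝ := fun s => p s ^ (1 - l) * q (T s) ^ l * ((1 - l) + l * (p s / q (T s))) with hD
  have hDp : ∀ s ∈ Ioo a b, p s ≤ D s := fun s hs =>
    mul_rpow_weighted_ge (hp0 s hs) (hq0 _ (hTmem s hs)) hl hl1
  have hTc : ContinuousOn T (Ioo a b) := fun s hs => (hTd s hs).continuousAt.continuousWithinAt
  have hqT : ContinuousOn (fun s => q (T s)) (Ioo a b) := hq.comp hTc hTmem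
  have hDc : ContinuousOn D (Ioo a b) := by
    refine ((hp.rpow_const fun s hs => Or.inl (hp0 s hs).ne').mul
      (hqT.rpow_const fun s hs => Or.inl (hq0 _ (hTmem s hs)).ne')).mul
      (continuousOn_const.add (continuousOn_const.mul (hp.div hqT ?_)))
    exact fun s hs => (hq0 _ (hTmem s hs)).ne'
  have hpI : IntegrableOn p (Ioo a b) := by
    rw [intervalIntegrable_iff_integrableOn_Ioo_of_le hab.le] at hpi; exact hpi
  have hp1' : ∫ s in Ioo a b, p s = 1 := by
    rw [← integral_Ioc_eq_integral_Ioo, ← intervalIntegral.integral_of_le hab.le, hp1]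
  have hp1'' : ∫⁻ s in Ioo a b, ENNReal.ofReal (p s) = 1 := by
    rw [← ofReal_integral_eq_lintegral_ofReal hpI, hp1', ENNReal.ofReal_one]
    exact (ae_restrict_iff' measurableSet_Ioo).2 (.of_forall fun s hs => (hp0 s hs).le)
  set z : ℝ → ℝ := fun s => (1 - l) * s + l * T s with hz
  have hzd : ∀ s ∈ Ioo a b, HasDerivAt z ((1 - l) + l * (p s / q (T s))) s := by
    intro s hs
    have := ((hasDerivAt_id s).const_mul (1 - l)).add ((hTd s hs).const_mul l)
    rw [mul_one] at this
    exact this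
  have hzi : InjOn z (Ioo a b) := by
    have : StrictMonoOn z (Ioo a b) := by
      intro s hs t ht hst
      have := hTm hs ht hst
      simp only [hz]
      nlinarith
    exact this.injOn
  have hDr : ∫⁻ s in Ioo a b, ENNReal.ofReal (D s) ≤ ∫⁻ x, r x := by
    calc ∫⁻ s in Ioo a b, ENNReal.ofReal (D s)
        ≤ ∫⁻ s in Ioo a b, ENNReal.ofReal |(1 - l) + l * (p s / q (T s))| * r (z s) := by
          refine setLIntegral_mono' measurableSet_Ioo fun s hs => ?_
          have h1 := hp0 s hs
          have h2 := hq0 _ (hTmem s hs)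
          have hl2 : 0 < 1 - l := by linarith
          have h3 : 0 < (1 - l) + l * (p s / q (T s)) := by positivity
          simp only [hD]
          rw [abs_of_pos h3, mul_comm, ENNReal.ofReal_mul h3.le]
          gcongr
          exact hr s hs _ (hTmem s hs)
      _ = ∫⁻ x in z '' Ioo a b, r x := by
          rw [lintegral_image_eq_lintegral_abs_deriv_mul measurableSet_Ioo
            (fun s hs => (hzd s hs).hasDerivWithinAt) hzi]
      _ ≤ ∫⁻ x, r x := setLIntegral_le_lintegral _ _
  constructor
  · rw [← hp1'']
    refine le_trans (setLIntegral_mono' measurableSet_Ioo fun s hs => ?_) hDr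
    exact ENNReal.ofReal_le_ofReal (hDp s hs)
  · intro hr1
    have hDm : AEStronglyMeasurable D (volume.restrict (Ioo a b)) :=
      hDc.aestronglyMeasurable measurableSet_Ioo
    have hDnn : 0 ≤ᵐ[volume.restrict (Ioo a b)] D :=
      (ae_restrict_iff' measurableSet_Ioo).2
        (.of_forall fun s hs => (hp0 s hs).le.trans (hDp s hs))
    have hDI : IntegrableOn D (Ioo a b) :=
      (lintegral_ofReal_ne_top_iff_integrable hDm hDnn).1
        (ne_top_of_le_ne_top ENNReal.one_ne_top (hDr.trans hr1))
    have hae : p =ᵐ[volume.restrict (Ioo a b)] D := by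
      have hle : p ≤ᵐ[volume.restrict (Ioo a b)] D :=
        (ae_restrict_iff' measurableSet_Ioo).2 (.of_forall hDp)
      refine (integral_eq_iff_of_ae_le hpI hDI hle).1 (le_antisymm (integral_mono_ae hpI hDI hle) ?_)
      rw [hp1']
      rw [← ENNReal.ofReal_le_one]
      rw [ofReal_integral_eq_lintegral_ofReal hDI hDnn]
      exact hDr.trans hr1
    -- Since p ≤ D and the integrals agree, p = D almost everywhere; continuity removes the null
    -- set, and strict Bernoulli then forces p = q ∘ T, that is T' = 1.
    have heq : EqOn p D (Ioo a b) := Measure.eqOn_open_of_ae_eq hae isOpen_Ioo hp hDc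
    have hpq : ∀ s ∈ Ioo a b, p s = q (T s) := by
      intro s hs
      by_contra hne
      exact absurd (heq hs) (mul_rpow_weighted_gt (hp0 s hs) (hq0 _ (hTmem s hs)) hl hl1 hne).ne
    obtain ⟨c, hc⟩ : ∃ c, ∀ s ∈ Ioo a b, T s = s + c := by
      obtain ⟨c, hc⟩ := isOpen_Ioo.exists_is_const_of_deriv_eq_zero (s := Ioo a b) (f := fun s => T s - s)
        isPreconnected_Ioo
        (fun s hs => ((hTd s hs).sub (hasDerivAt_id s)).differentiableAt.differentiableWithinAt)
        (fun s hs => by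
          have := ((hTd s hs).sub (hasDerivAt_id s)).deriv
          rw [← hpq s hs, div_self (hp0 s hs).ne', sub_self] at this
          exact this)
      exact ⟨c, fun s hs => sub_eq_iff_eq_add'.1 (hc s hs)⟩
    have himg : Ioo (a + c) (b + c) = Ioo a' b' := by
      rw [← hTi, image_congr hc, image_add_const_Ioo]
    have hinf := congrArg sInf himg
    have hsup := congrArg sSup himg
    rw [csInf_Ioo (by linarith), csInf_Ioo hab'] at hinf
    rw [csSup_Ioo (by linarith), csSup_Ioo hab'] at hsup
    refine ⟨c, hinf.symm, hsup.symm, fun s hs => ?_⟩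
    rw [hpq s hs, hc s hs]

/-! ### Brunn–Minkowski by slicing. -/

/-- The multiplicative Brunn–Minkowski inequality for compact convex sets. -/
def BrunnMinkowskiMul {E : Type*} [NormedAddCommGroup E] [NormedSpace ℝ E] [MeasurableSpace E]
    (μ : Measure E) : Prop :=
  ∀ K L : Set E, IsCompact K → Convex ℝ K → K.Nonempty → IsCompact L → Convex ℝ L → L.Nonempty →
    ∀ l : ℝ, 0 < l → l < 1 → μ.real K ^ (1 - l) * μ.real L ^ l ≤ μ.real ((1 - l) • K + l • L)

/-- The volume of the slice of `K` over `t`. -/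
noncomputable def sliceVolume {k : ℕ} (K : Set (ℝ × (Fin k → ℝ))) (t : ℝ) : ℝ :=
  volume.real (Prod.mk t ⁻¹' K)

section slices

variable {k : ℕ} {K L : Set (ℝ × (Fin k → ℝ))}

theorem isCompact_slice (hK : IsCompact K) (t : ℝ) : IsCompact (Prod.mk t ⁻¹' K) := by
  exact (Topology.IsClosedEmbedding.of_continuous_injective_isClosedMap (by fun_prop)
    (Prod.mk_right_injective t) (isClosedMap_prodMk_left t)).isCompact_preimage hK

theorem convex_slice (hK : Convex ℝ K) (t : ℝ) : Convex ℝ (Prod.mk t ⁻¹' K) := by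
  intro x hx y hy a b ha hb hab
  have := hK hx hy ha hb hab
  have e : a • (t, x) + b • (t, y) = (t, a • x + b • y) := by
    ext <;> simp [← add_mul, hab]
  rwa [e] at this

theorem sliceVolume_nonneg (t : ℝ) : 0 ≤ sliceVolume K t := measureReal_nonneg

theorem ofReal_sliceVolume (hK : IsCompact K) (t : ℝ) :
    ENNReal.ofReal (sliceVolume K t) = volume (Prod.mk t ⁻¹' K) :=
  ofReal_measureReal (isCompact_slice hK t).measure_ne_top

theorem volume_inter_fst_preimage (hK : IsCompact K) {S : Set ℝ} (hS : MeasurableSet S) :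
    volume (K ∩ Prod.fst ⁻¹' S) = ∫⁻ t in S, ENNReal.ofReal (sliceVolume K t) := by
  rw [Measure.volume_eq_prod, Measure.prod_apply (hK.measurableSet.inter (measurable_fst hS)),
    ← lintegral_indicator hS]
  congr 1 with t
  by_cases ht : t ∈ S
  · rw [indicator_of_mem ht, ofReal_sliceVolume hK]
    congr 1; ext y; simp [ht]
  · rw [indicator_of_notMem ht]
    convert measure_empty (μ := (volume : Measure (Fin k → ℝ)))
    ext y; simp [ht]

theorem measurable_sliceVolume (hK : IsCompact K) : Measurable (sliceVolume K) :=
  (measurable_measure_prodMk_left hK.measurableSet).ennreal_toReal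

/-- The slice of a Minkowski combination contains the combination of the slices, so the inequality
one dimension lower gives the hypothesis of Prékopa–Leindler. -/
theorem sliceVolume_mul_le (hBM : BrunnMinkowskiMul (volume : Measure (Fin k → ℝ)))
    (hK : IsCompact K) (hKc : Convex ℝ K) (hL : IsCompact L) (hLc : Convex ℝ L) {l : ℝ}
    (hl : 0 < l) (hl1 : l < 1) (s t : ℝ) :
    sliceVolume K s ^ (1 - l) * sliceVolume L t ^ l ≤
      sliceVolume ((1 - l) • K + l • L) ((1 - l) * s + l * t) := by
  rcases (Prod.mk s ⁻¹' K).eq_empty_or_nonempty with h1 | h1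
  · rw [show sliceVolume K s = 0 by simp [sliceVolume, h1], Real.zero_rpow (by linarith), zero_mul]
    exact sliceVolume_nonneg _
  rcases (Prod.mk t ⁻¹' L).eq_empty_or_nonempty with h2 | h2
  · rw [show sliceVolume L t = 0 by simp [sliceVolume, h2], Real.zero_rpow hl.ne', mul_zero]
    exact sliceVolume_nonneg _
  refine (hBM _ _ (isCompact_slice hK s) (convex_slice hKc s) h1 (isCompact_slice hL t)
    (convex_slice hLc t) h2 l hl hl1).trans ?_
  refine measureReal_mono ?_ (isCompact_slice ((hK.smul _).add (hL.smul _)) _).measure_ne_top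
  rintro _ ⟨_, ⟨x, hx, rfl⟩, _, ⟨y, hy, rfl⟩, rfl⟩
  exact ⟨(1 - l) • (s, x), ⟨_, hx, rfl⟩, l • (t, y), ⟨_, hy, rfl⟩, by simp⟩

/-- Slice volumes are log-concave. Hence they are positive on an interval and continuous in its
interior; at the endpoints they may jump, so nothing is claimed there. -/
theorem exists_sliceVolume_density (hBM : BrunnMinkowskiMul (volume : Measure (Fin k → ℝ)))
    (hK : IsCompact K) (hKc : Convex ℝ K) (hK0 : 0 < volume.real K) :
    ∃ a b, a < b ∧ ContinuousOn (sliceVolume K) (Ioo a b) ∧ (∀ t ∈ Ioo a b, 0 < sliceVolume K t) ∧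
      (∀ t ∉ Icc a b, sliceVolume K t = 0) ∧ IntervalIntegrable (sliceVolume K) volume a b ∧
      ∫ t in a..b, sliceVolume K t = volume.real K := by
  set p := sliceVolume K with hp
  have hnn : ∀ t, 0 ≤ p t := fun t => sliceVolume_nonneg t
  have hvol : ∫⁻ t, ENNReal.ofReal (p t) = volume K := by
    have := volume_inter_fst_preimage hK MeasurableSet.univ
    simpa using this.symm
  have hint : Integrable p := by
    refine (lintegral_ofReal_ne_top_iff_integrable (measurable_sliceVolume hK).aestronglyMeasurable
      (.of_forall hnn)).1 ?_
    rw [hvol]; exact hK.measure_ne_top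
  have hintK : ∫ t, p t = volume.real K := by
    rw [integral_eq_lintegral_of_nonneg_ae (.of_forall hnn) hint.1, hvol]; rfl
  -- Slicing with L = K, where convexity gives (1-l) K + l K = K.
  have hself : ∀ l : ℝ, 0 < l → l < 1 → ∀ s t, p s ^ (1 - l) * p t ^ l ≤ p ((1 - l) * s + l * t) := by
    intro l hl hl1 s t
    have h := sliceVolume_mul_le hBM hK hKc hK hKc hl hl1 s t
    rwa [← hKc.add_smul (by linarith) hl.le, sub_add_cancel, one_smul] at h
  set J : Set ℝ := {t | 0 < p t} with hJ
  have hJc : Convex ℝ J := by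
    rw [convex_iff_forall_pos]
    intro s hs t ht a b ha hb hab
    obtain rfl : a = 1 - b := by linarith
    refine lt_of_lt_of_le ?_ (hself b hb (by linarith) s t)
    exact mul_pos (Real.rpow_pos_of_pos hs _) (Real.rpow_pos_of_pos ht _)
  have hJne : J.Nonempty := by
    by_contra h
    rw [not_nonempty_iff_eq_empty, eq_empty_iff_forall_notMem] at h
    have : ∀ t, p t = 0 := fun t => le_antisymm (not_lt.1 (h t)) (hnn t)
    rw [← hintK] at hK0
    simp [this] at hK0
  have hJsub : J ⊆ Prod.fst '' K := by
    intro t ht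
    by_contra h
    have : Prod.mk t ⁻¹' K = ∅ := by
      ext y
      simp only [mem_preimage, mem_empty_iff_false, iff_false]
      exact fun hy => h ⟨_, hy, rfl⟩
    have ht' : (0:ℝ) < volume.real (Prod.mk t ⁻¹' K) := ht
    rw [this] at ht'
    simp at ht'
  have hbd := (hK.image continuous_fst).isBounded.subset hJsub
  have hbb := hbd.bddBelow
  have hba := hbd.bddAbove
  set a := sInf J
  set b := sSup J
  have hIoo : Ioo a b ⊆ J := by
    intro t ht
    obtain ⟨s1, hs1, h1⟩ := exists_lt_of_csInf_lt hJne ht.1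
    obtain ⟨s2, hs2, h2⟩ := exists_lt_of_lt_csSup hJne ht.2
    exact hJc.ordConnected.out hs1 hs2 ⟨h1.le, h2.le⟩
  have hout : ∀ t ∉ Icc a b, p t = 0 := by
    intro t ht
    by_contra h
    have : t ∈ J := lt_of_le_of_ne (hnn t) (Ne.symm h)
    exact ht ⟨csInf_le hbb this, le_csSup hba this⟩
  have hIcc : ∫ t in Icc a b, p t = volume.real K := by
    rw [setIntegral_eq_integral_of_forall_compl_eq_zero hout, hintK]
  have hab : a < b := by
    by_contra h
    rw [not_lt] at h
    have h0 : (volume.restrict (Icc a b)) = 0 := by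
      rw [Measure.restrict_eq_zero, Real.volume_Icc, ENNReal.ofReal_eq_zero]; linarith
    rw [h0, integral_zero_measure] at hIcc
    linarith
  refine ⟨a, b, hab, ?_, hIoo, hout, hint.intervalIntegrable, ?_⟩
  · have hlog : ConcaveOn ℝ (Ioo a b) (fun t => Real.log (p t)) := by
      rw [concaveOn_iff_forall_pos]
      refine ⟨convex_Ioo a b, ?_⟩
      intro s hs t ht u v hu hv huv
      obtain rfl : u = 1 - v := by linarith
      have h1 : 0 < p s := hIoo hs
      have h2 : 0 < p t := hIoo ht
      have h := Real.log_le_log (mul_pos (Real.rpow_pos_of_pos h1 _) (Real.rpow_pos_of_pos h2 _))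
        (hself v hv (by linarith) s t)
      rw [Real.log_mul (Real.rpow_pos_of_pos h1 _).ne' (Real.rpow_pos_of_pos h2 _).ne',
        Real.log_rpow h1, Real.log_rpow h2] at h
      simpa using h
    refine ((hlog.continuousOn isOpen_Ioo).rexp).congr fun t ht => ?_
    exact (Real.exp_log (hIoo ht)).symm
  · rw [intervalIntegral.integral_of_le hab.le, ← integral_Icc_eq_integral_Ioc, hIcc]

/-- Prékopa–Leindler applied to the slice volumes divided by total volume. In its equality case the
slice volumes of L are those of K shifted by c, stated as a translation of marginals, a form
independent of coordinates. -/
theorem brunnMinkowskiMul_prod_aux (hBM : BrunnMinkowskiMul (volume : Measure (Fin k → ℝ)))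
    (hK : IsCompact K) (hKc : Convex ℝ K) (hL : IsCompact L) (hLc : Convex ℝ L) {l : ℝ}
    (hl : 0 < l) (hl1 : l < 1) (hK0 : 0 < volume.real K) (hL0 : 0 < volume.real L) :
    volume.real K ^ (1 - l) * volume.real L ^ l ≤ volume.real ((1 - l) • K + l • L) ∧
    (volume.real K = volume.real L → volume.real ((1 - l) • K + l • L) ≤ volume.real K →
      ∃ c, ∀ S : Set ℝ, MeasurableSet S →
        volume (L ∩ Prod.fst ⁻¹' S) = volume (K ∩ Prod.fst ⁻¹' ((fun t => t + c) ⁻¹' S))) := by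
  obtain ⟨a, b, hab, hpc, hp0, hpz, hpi, hpI⟩ := exists_sliceVolume_density hBM hK hKc hK0
  obtain ⟨a', b', hab', hqc, hq0, hqz, hqi, hqI⟩ := exists_sliceVolume_density hBM hL hLc hL0
  set P := volume.real K
  set Q := volume.real L
  set M := (1 - l) • K + l • L with hM
  have hMc : IsCompact M := (hK.smul _).add (hL.smul _)
  set C : ℝ := P ^ (1 - l) * Q ^ l with hC
  have hC0 : 0 < C := mul_pos (Real.rpow_pos_of_pos hK0 _) (Real.rpow_pos_of_pos hL0 _)
  have hMv : volume M = ∫⁻ t, ENNReal.ofReal (sliceVolume M t) := by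
    simpa using volume_inter_fst_preimage hMc MeasurableSet.univ
  have hrint : ∫⁻ t, ENNReal.ofReal (sliceVolume M t / C) = ENNReal.ofReal (volume.real M / C) := by
    simp_rw [div_eq_mul_inv, ENNReal.ofReal_mul (sliceVolume_nonneg _),
      ENNReal.ofReal_mul measureReal_nonneg]
    rw [lintegral_mul_const _ (measurable_sliceVolume hMc).ennreal_ofReal, ← hMv,
      ofReal_measureReal hMc.measure_ne_top]
  have main := prekopa_leindler_Ioo (p := fun t => sliceVolume K t / P)
    (q := fun t => sliceVolume L t / Q) (r := fun t => ENNReal.ofReal (sliceVolume M t / C))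
    hl hl1 hab hab' (hpc.div_const _) (fun s hs => div_pos (hp0 s hs) hK0) (hpi.div_const _)
    (by rw [intervalIntegral.integral_div, hpI, div_self hK0.ne'])
    (hqc.div_const _) (fun s hs => div_pos (hq0 s hs) hL0) (hqi.div_const _)
    (by rw [intervalIntegral.integral_div, hqI, div_self hL0.ne'])
    (by
      intro s _ t _
      apply ENNReal.ofReal_le_ofReal
      rw [Real.div_rpow (sliceVolume_nonneg s) hK0.le, Real.div_rpow (sliceVolume_nonneg t) hL0.le,
        div_mul_div_comm]
      gcongr
      exact sliceVolume_mul_le hBM hK hKc hL hLc hl hl1 s t)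
  rw [hrint] at main
  refine ⟨?_, ?_⟩
  · have := main.1
    rwa [← ENNReal.ofReal_one, ENNReal.ofReal_le_ofReal_iff (by positivity), one_le_div hC0] at this
  · intro hPQ hle
    have hCP : C = P := by
      rw [hC, ← hPQ, ← Real.rpow_add hK0]; simp
    obtain ⟨c, ha, hb, hc⟩ := main.2 (by
      rw [ENNReal.ofReal_le_one, div_le_one hC0, hCP]; exact hle)
    -- The two endpoints, where the densities are not controlled, form a null set.
    have hc' : ∀ᵐ t, sliceVolume L (t + c) = sliceVolume K t := by
      have h1 : ∀ᵐ t : ℝ, t ≠ a := by simp [ae_iff]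
      have h2 : ∀ᵐ t : ℝ, t ≠ b := by simp [ae_iff]
      filter_upwards [h1, h2] with t hta htb
      by_cases ht : t ∈ Icc a b
      · have := hc t ⟨lt_of_le_of_ne ht.1 (Ne.symm hta), lt_of_le_of_ne ht.2 htb⟩
        rw [← hPQ] at this
        exact (div_left_inj' hK0.ne').1 this
      · rw [hpz t ht, hqz]
        rw [ha, hb]
        intro h
        exact ht ⟨by linarith [h.1], by linarith [h.2]⟩
    refine ⟨c, fun S hS => ?_⟩
    have hS' : MeasurableSet ((fun t => t + c) ⁻¹' S) := (measurable_add_const c) hS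
    rw [volume_inter_fst_preimage hL hS, volume_inter_fst_preimage hK hS', ← lintegral_indicator hS,
      ← lintegral_indicator hS', ← lintegral_add_right_eq_self _ c]
    refine lintegral_congr_ae ?_
    filter_upwards [hc'] with t ht
    by_cases h : t + c ∈ S
    · rw [indicator_of_mem h, indicator_of_mem (by exact h), ht]
    · rw [indicator_of_notMem h, indicator_of_notMem (by exact h)]

theorem brunnMinkowskiMul_prod (hBM : BrunnMinkowskiMul (volume : Measure (Fin k → ℝ))) :
    BrunnMinkowskiMul (volume : Measure (ℝ × (Fin k → ℝ))) := by
  intro K L hK hKc _ hL hLc _ l hl hl1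
  rcases (measureReal_nonneg (μ := volume) (s := K)).eq_or_lt' with h | h
  · rw [h, Real.zero_rpow (by linarith), zero_mul]; exact measureReal_nonneg
  rcases (measureReal_nonneg (μ := volume) (s := L)).eq_or_lt' with h' | h'
  · rw [h', Real.zero_rpow hl.ne', mul_zero]; exact measureReal_nonneg
  exact (brunnMinkowskiMul_prod_aux hBM hK hKc hL hLc hl hl1 h h').1

end slices

/-! ### Change of coordinates, and marginals along an arbitrary functional. -/

theorem image_smul_add_smul {E F : Type*} [NormedAddCommGroup E] [NormedSpace ℝ E]
    [NormedAddCommGroup F] [NormedSpace ℝ F] (e : E ≃L[ℝ] F) (K L : Set E) (a b : ℝ) :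
    e '' (a • K + b • L) = a • (e '' K) + b • (e '' L) := by
  rw [image_add, image_smul_set, image_smul_set]

/-- Splitting E as a line plus the kernel of f turns slices over the first coordinate into level
sets of f. -/
theorem exists_continuousLinearEquiv_prod_fst {E : Type*} [NormedAddCommGroup E] [NormedSpace ℝ E]
    [FiniteDimensional ℝ E] {k : ℕ} (hk : Module.finrank ℝ E = k + 1)
    {f : E →L[ℝ] ℝ} (hf : f ≠ 0) : ∃ e : E ≃L[ℝ] ℝ × (Fin k → ℝ), ∀ x, (e x).1 = f x := by
  obtain ⟨v, hv⟩ : ∃ v, f v ≠ 0 := by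
    by_contra h; push Not at h; exact hf (ContinuousLinearMap.ext h)
  let g : ℝ →L[ℝ] E := ContinuousLinearMap.toSpanSingleton ℝ ((f v)⁻¹ • v)
  have hg : Function.RightInverse g f := by
    intro t; simp [g, hv]
  let e₁ := ContinuousLinearEquiv.equivOfRightInverse f g hg
  have hrank : Module.finrank ℝ f.ker = Module.finrank ℝ (Fin k → ℝ) := by
    have h := e₁.toLinearEquiv.finrank_eq
    rw [Module.finrank_prod, Module.finrank_self, hk] at h
    simp; omega
  refine ⟨e₁.trans ((ContinuousLinearEquiv.refl ℝ ℝ).prodCongr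
    (ContinuousLinearEquiv.ofFinrankEq hrank)), fun x => ?_⟩
  simp [e₁]

instance isAddHaarMeasure_volume_prod_pi (k : ℕ) :
    (volume : Measure (ℝ × (Fin k → ℝ))).IsAddHaarMeasure :=
  Measure.prod.instIsAddHaarMeasure _ _

section transfer

variable {E F : Type*} [NormedAddCommGroup E] [NormedSpace ℝ E] [MeasurableSpace E] [BorelSpace E]
  [NormedAddCommGroup F] [NormedSpace ℝ F] [MeasurableSpace F]
  [BorelSpace F] [FiniteDimensional ℝ F]

theorem exists_measure_image_eq_smul (e : E ≃L[ℝ] F) (μ : Measure E) [μ.IsAddHaarMeasure]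
    (ν : Measure F) [ν.IsAddHaarMeasure] :
    ∃ c : NNReal, 0 < c ∧ ∀ K : Set E, μ K = c * ν (e '' K) := by
  have : (μ.map e).IsAddHaarMeasure := e.isAddHaarMeasure_map μ
  refine ⟨(μ.map e).addHaarScalarFactor ν, Measure.addHaarScalarFactor_pos_of_isAddHaarMeasure _ _,
    fun K => ?_⟩
  have h := Measure.isAddLeftInvariant_eq_smul (μ.map e) ν
  have h2 := congrArg (fun m : Measure F => m (e '' K)) h
  simp only [Measure.smul_apply] at h2
  have he : MeasurableEmbedding e := e.toHomeomorph.measurableEmbedding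
  rw [he.map_apply, e.injective.preimage_image] at h2
  exact h2

/-- Haar measures correspond up to a constant factor, which cancels because the exponents 1 - l and
l add up to one. -/
theorem BrunnMinkowskiMul.of_equiv (e : E ≃L[ℝ] F) {μ : Measure E} [μ.IsAddHaarMeasure]
    {ν : Measure F} [ν.IsAddHaarMeasure] (h : BrunnMinkowskiMul ν) : BrunnMinkowskiMul μ := by
  intro K L hK hKc hKn hL hLc hLn l hl hl1
  obtain ⟨c, hc, hcK⟩ := exists_measure_image_eq_smul e μ ν
  have hr : ∀ K : Set E, μ.real K = c * ν.real (e '' K) := by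
    intro K; simp [Measure.real, hcK]
  rw [hr, hr, hr, image_smul_add_smul, Real.mul_rpow (by positivity) (by positivity),
    Real.mul_rpow (by positivity) (by positivity), mul_mul_mul_comm,
    ← Real.rpow_add (by exact_mod_cast hc), sub_add_cancel, Real.rpow_one]
  gcongr
  exact h _ _ (hK.image e.continuous) (hKc.linear_image e.toLinearMap) (hKn.image _)
    (hL.image e.continuous) (hLc.linear_image e.toLinearMap) (hLn.image _) l hl hl1

theorem brunnMinkowskiMul_volume_pi (k : ℕ) :
    BrunnMinkowskiMul (volume : Measure (Fin k → ℝ)) := by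
  induction k with
  | zero =>
    intro K L _ _ hK _ _ hL l _ _
    have hK' : K = univ := Subsingleton.eq_univ_of_nonempty hK
    have hL' : L = univ := Subsingleton.eq_univ_of_nonempty hL
    have hM : (1 - l) • K + l • L = univ :=
      Subsingleton.eq_univ_of_nonempty (hK.smul_set.add hL.smul_set)
    have hu : volume.real (univ : Set (Fin 0 → ℝ)) = 1 := by
      simp [Measure.real, volume_pi]
    rw [hM, hK', hL', hu]; simp
  | succ k ih =>
    have e : (Fin (k + 1) → ℝ) ≃L[ℝ] ℝ × (Fin k → ℝ) :=
      ContinuousLinearEquiv.ofFinrankEq (by simp [add_comm])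
    exact (brunnMinkowskiMul_prod ih).of_equiv e

/-- In the equality case of the multiplicative Brunn–Minkowski inequality for two sets of the same
volume, the images of the two restricted measures under any linear functional are translates of
each other. -/
theorem exists_marginal_translate [FiniteDimensional ℝ E] {μ : Measure E} [μ.IsAddHaarMeasure] {K L : Set E}
    (hK : IsCompact K) (hKc : Convex ℝ K) (hL : IsCompact L) (hLc : Convex ℝ L) {l : ℝ}
    (hl : 0 < l) (hl1 : l < 1) (hK0 : 0 < μ.real K) (hKL : μ.real K = μ.real L)
    (hle : μ.real ((1 - l) • K + l • L) ≤ μ.real K) {f : E →L[ℝ] ℝ} (hf : f ≠ 0) :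
    ∃ c, ∀ S : Set ℝ, MeasurableSet S →
      μ (L ∩ f ⁻¹' S) = μ (K ∩ f ⁻¹' ((fun t => t + c) ⁻¹' S)) := by
  have hpos : 0 < Module.finrank ℝ E := by
    have : Nontrivial E := by
      obtain ⟨v, hv⟩ : ∃ v, f v ≠ 0 := by
        by_contra h; push Not at h; exact hf (ContinuousLinearMap.ext h)
      exact ⟨v, 0, fun h => hv (by rw [h, map_zero])⟩
    exact Module.finrank_pos
  obtain ⟨k, hk⟩ : ∃ k, Module.finrank ℝ E = k + 1 := ⟨_, (Nat.succ_pred_eq_of_pos hpos).symm⟩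
  obtain ⟨e, he⟩ := exists_continuousLinearEquiv_prod_fst hk hf
  obtain ⟨c, hc, hcK⟩ := exists_measure_image_eq_smul e μ (volume : Measure (ℝ × (Fin k → ℝ)))
  have hr : ∀ K : Set E, μ.real K = c * volume.real (e '' K) := by
    intro K; simp [Measure.real, hcK]
  have hc' : (0:ℝ) < c := hc
  rw [hr] at hK0
  rw [hr, hr, mul_right_inj' hc'.ne'] at hKL
  rw [hr, hr, image_smul_add_smul, mul_le_mul_iff_right₀ hc'] at hle
  have hK0' := pos_of_mul_pos_right hK0 hc'.le
  obtain ⟨d, hd⟩ := (brunnMinkowskiMul_prod_aux (brunnMinkowskiMul_volume_pi k)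
    (hK.image e.continuous) (hKc.linear_image e.toLinearMap)
    (hL.image e.continuous) (hLc.linear_image e.toLinearMap) hl hl1 hK0' (hKL ▸ hK0')).2 hKL hle
  refine ⟨d, fun S hS => ?_⟩
  have him : ∀ (K : Set E) (S : Set ℝ), e '' (K ∩ f ⁻¹' S) = e '' K ∩ Prod.fst ⁻¹' S := by
    intro K S
    rw [← image_inter_preimage, ← preimage_comp]
    congr 2; ext x; simp [he]
  rw [hcK, hcK, him, him]
  exact congrArg _ (hd S hS)

end transfer

/-! ### Equality in Brunn–Minkowski: the bodies are translates. -/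

section translates

variable {E : Type*} [NormedAddCommGroup E] [NormedSpace ℝ E] [MeasurableSpace E] [BorelSpace E]
  [FiniteDimensional ℝ E] {μ : Measure E} [μ.IsAddHaarMeasure] {K L : Set E}

theorem interior_nonempty_of_measureReal_pos (hK : Convex ℝ K) (hK0 : 0 < μ.real K) :
    (interior K).Nonempty := by
  by_contra h
  rw [not_nonempty_iff_eq_empty] at h
  have h1 : K ⊆ frontier K := by
    rw [frontier, h, sdiff_empty]; exact subset_closure
  have h2 : μ K = 0 := measure_mono_null h1 (hK.addHaar_frontier μ)
  simp [Measure.real, h2] at hK0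

/-- A point of L outside K + v is separated from it by a functional f. Near that point L has
positive mass beyond the hyperplane while K + v has none, contradicting the marginals along f. -/
theorem subset_translate_of_marginals (hK : IsCompact K) (hKc : Convex ℝ K) (hKn : K.Nonempty)
    (hLc : Convex ℝ L) (hL0 : 0 < μ.real L) {v : E}
    (h : ∀ f : E →L[ℝ] ℝ, f ≠ 0 → ∀ S : Set ℝ, MeasurableSet S →
      μ (L ∩ f ⁻¹' S) = μ (K ∩ f ⁻¹' ((fun t => t + f v) ⁻¹' S))) :
    L ⊆ K + {v} := by
  intro y hy
  by_contra hyK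
  have hyv : y - v ∉ K := fun hm => hyK ⟨y - v, hm, v, rfl, by simp⟩
  obtain ⟨f, u, hfK, hfy⟩ := geometric_hahn_banach_closed_point hKc hK.isClosed hyv
  have hf : f ≠ 0 := by
    rintro rfl
    obtain ⟨x, hx⟩ := hKn
    have h1 := hfK x hx
    simp only [zero_apply] at h1 hfy
    exact lt_asymm h1 hfy
  have h1 := h f hf (Ioi (u + f v)) measurableSet_Ioi
  have h2 : K ∩ f ⁻¹' ((fun t => t + f v) ⁻¹' Ioi (u + f v)) = ∅ := by
    rw [eq_empty_iff_forall_notMem]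
    rintro x ⟨hx, hx2⟩
    have := hfK x hx
    simp only [mem_preimage, mem_Ioi] at hx2
    linarith
  rw [h2, measure_empty] at h1
  have hU : IsOpen (f ⁻¹' Ioi (u + f v)) := isOpen_Ioi.preimage f.continuous
  have hyU : y ∈ f ⁻¹' Ioi (u + f v) := by
    rw [map_sub] at hfy
    simp only [mem_preimage, mem_Ioi]; linarith
  -- The point y may lie on the boundary of L; positive mass comes from nearby interior points.
  have hycl : y ∈ closure (interior L) := by
    rw [hLc.closure_interior_eq_closure_of_nonempty_interior
      (interior_nonempty_of_measureReal_pos hLc hL0)]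
    exact subset_closure hy
  obtain ⟨z, hzU, hzL⟩ := mem_closure_iff.1 hycl _ hU hyU
  have h3 : 0 < μ (interior L ∩ f ⁻¹' Ioi (u + f v)) :=
    (isOpen_interior.inter hU).measure_pos μ ⟨z, hzL, hzU⟩
  exact h3.ne' (measure_mono_null (inter_subset_inter_left _ interior_subset) h1)

theorem eq_translate_of_brunnMinkowski_eq (hK : IsCompact K) (hKc : Convex ℝ K)
    (hL : IsCompact L) (hLc : Convex ℝ L) {l : ℝ}
    (hl : 0 < l) (hl1 : l < 1) (hK0 : 0 < μ.real K) (hKL : μ.real K = μ.real L)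
    (hle : μ.real ((1 - l) • K + l • L) ≤ μ.real K) : ∃ v, L = K + {v} := by
  have hne : ∀ {K : Set E}, 0 < μ.real K → K.Nonempty := by
    intro K h
    by_contra hh
    rw [not_nonempty_iff_eq_empty] at hh
    simp [hh] at h
  have hint : ∀ {K : Set E}, IsCompact K → IntegrableOn (fun x : E => x) K μ := fun hK =>
    continuousOn_id.integrableOn_compact hK
  -- The difference of the centroids. Integrating f against both marginals shows that the shift
  -- along f is f v, so one vector serves all functionals.
  set v : E := (μ.real K)⁻¹ • (∫ x in L, x ∂μ - ∫ x in K, x ∂μ) with hv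
  have h : ∀ f : E →L[ℝ] ℝ, f ≠ 0 → ∀ S : Set ℝ, MeasurableSet S →
      μ (L ∩ f ⁻¹' S) = μ (K ∩ f ⁻¹' ((fun t => t + f v) ⁻¹' S)) := by
    intro f hf
    obtain ⟨c, hc⟩ := exists_marginal_translate hK hKc hL hLc hl hl1 hK0 hKL hle hf
    have hmap : (μ.restrict L).map f = (μ.restrict K).map (fun x => f x + c) := by
      ext S hS
      rw [Measure.map_apply f.continuous.measurable hS,
        Measure.map_apply (by fun_prop) hS,
        Measure.restrict_apply (f.continuous.measurable hS),
        Measure.restrict_apply ((by fun_prop : Measurable (fun x => f x + c)) hS),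
        inter_comm, hc S hS, inter_comm]
      rfl
    have h1 : ∫ x in L, f x ∂μ = ∫ x in K, (f x + c) ∂μ := by
      have e1 := integral_map (μ := μ.restrict L) (φ := f) (f := fun t : ℝ => t)
        f.continuous.aemeasurable (by fun_prop)
      have e2 := integral_map (μ := μ.restrict K) (φ := fun x => f x + c) (f := fun t : ℝ => t)
        (by fun_prop) (by fun_prop)
      rw [← e1, hmap, e2]
    have hKi : IntegrableOn (fun x => f x) K μ := f.integrable_comp (hint hK)
    have hc0 : IntegrableOn (fun _ : E => c) K μ := integrableOn_const (hK.measure_ne_top)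
    rw [integral_add hKi hc0, setIntegral_const, f.integral_comp_comm (hint hL),
      f.integral_comp_comm (hint hK)] at h1
    have hcv : c = f v := by
      rw [hv, map_smul, map_sub, h1]
      simp [hK0.ne']
    rw [← hcv]; exact hc
  refine ⟨v, Subset.antisymm (subset_translate_of_marginals hK hKc (hne hK0) hLc (hKL ▸ hK0) h) ?_⟩
  have h' := subset_translate_of_marginals (v := -v) hL hLc (hne (hKL ▸ hK0)) hKc hK0
    (fun f hf S hS => by
      have hS' : MeasurableSet ((fun t => t + f (-v)) ⁻¹' S) := (measurable_add_const _) hS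
      rw [h f hf _ hS']
      congr 2
      ext x
      simp)
  rintro _ ⟨x, hx, _, rfl, rfl⟩
  obtain ⟨y, hy, _, rfl, rfl⟩ := h' hx
  simpa using hy

end translates

/-! ### The additive Brunn–Minkowski inequality for convex bodies. -/

section additive

variable {n : ℕ}

/-- The `n`-th root of the volume of a convex body in `ℝⁿ`. -/
noncomputable def volumeRoot (K : ConvexBody (EuclideanSpace ℝ (Fin n))) : ℝ :=
  volume.real (K : Set (EuclideanSpace ℝ (Fin n))) ^ ((1 : ℝ) / (n : ℝ))

theorem volumeRoot_nonneg (K : ConvexBody (EuclideanSpace ℝ (Fin n))) : 0 ≤ volumeRoot K :=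
  Real.rpow_nonneg measureReal_nonneg _

theorem volumeRoot_pow (hn : 1 ≤ n) (K : ConvexBody (EuclideanSpace ℝ (Fin n))) :
    volumeRoot K ^ n = volume.real (K : Set (EuclideanSpace ℝ (Fin n))) := by
  rw [volumeRoot, one_div, Real.rpow_inv_natCast_pow measureReal_nonneg (by omega)]

theorem volumeRoot_mono {K L : ConvexBody (EuclideanSpace ℝ (Fin n))}
    (h : (K : Set (EuclideanSpace ℝ (Fin n))) ⊆ L) : volumeRoot K ≤ volumeRoot L :=
  Real.rpow_le_rpow measureReal_nonneg (measureReal_mono h L.isCompact.measure_ne_top)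
    (by positivity)

theorem volumeRoot_eq_of_real_eq_pow (hn : 1 ≤ n) {K : ConvexBody (EuclideanSpace ℝ (Fin n))}
    {c : ℝ} (hc : 0 ≤ c) (h : volume.real (K : Set (EuclideanSpace ℝ (Fin n))) = c ^ n) :
    volumeRoot K = c := by
  rw [volumeRoot, h, one_div, Real.pow_rpow_inv_natCast hc (by omega)]

theorem real_smul_body (c : ℝ) (hc : 0 ≤ c) (K : Set (EuclideanSpace ℝ (Fin n))) :
    volume.real (c • K) = c ^ n * volume.real K := by
  rw [Measure.real, Measure.addHaar_smul_of_nonneg _ hc, ENNReal.toReal_mul,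
    ENNReal.toReal_ofReal (by positivity), finrank_euclideanSpace_fin, Measure.real]

theorem volumeRoot_smul (hn : 1 ≤ n) {c : ℝ} (hc : 0 ≤ c)
    (K : ConvexBody (EuclideanSpace ℝ (Fin n))) : volumeRoot (c • K) = c * volumeRoot K := by
  refine volumeRoot_eq_of_real_eq_pow hn (mul_nonneg hc (volumeRoot_nonneg K)) ?_
  rw [ConvexBody.coe_smul, real_smul_body c hc, mul_pow, volumeRoot_pow hn]

theorem real_add_singleton (K : Set (EuclideanSpace ℝ (Fin n))) (v : EuclideanSpace ℝ (Fin n)) :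
    volume.real (K + {v}) = volume.real K := by
  rw [add_singleton, Measure.real, Measure.real, image_add_right, measure_preimage_add_right]

theorem volumeRoot_le_add (K L : ConvexBody (EuclideanSpace ℝ (Fin n))) :
    volumeRoot K ≤ volumeRoot (K + L) := by
  obtain ⟨v, hv⟩ := L.nonempty
  rw [volumeRoot, ← real_add_singleton _ v]
  refine Real.rpow_le_rpow measureReal_nonneg (measureReal_mono ?_
    (K + L).isCompact.measure_ne_top) (by positivity)
  rw [ConvexBody.coe_add]
  exact add_subset_add_left (singleton_subset_iff.2 hv)

theorem real_inv_volumeRoot_smul (hn : 1 ≤ n) {K : ConvexBody (EuclideanSpace ℝ (Fin n))}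
    (hK : 0 < volumeRoot K) :
    volume.real ((volumeRoot K)⁻¹ • (K : Set (EuclideanSpace ℝ (Fin n)))) = 1 := by
  rw [real_smul_body _ (by positivity), ← volumeRoot_pow hn, ← mul_pow,
    inv_mul_cancel₀ hK.ne', one_pow]

/-- With this weight, combining the bodies normalized to volume one gives a rescaled K + L; this
passes from the multiplicative to the additive inequality. -/
theorem normalized_combination {a b : ℝ} (ha : 0 < a) (hb : 0 < b)
    (K L : Set (EuclideanSpace ℝ (Fin n))) :
    (1 - b / (a + b)) • (a⁻¹ • K) + (b / (a + b)) • (b⁻¹ • L) = (a + b)⁻¹ • (K + L) := by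
  have h1 : (1 - b / (a + b)) * a⁻¹ = (a + b)⁻¹ := by field_simp; ring
  have h2 : (b / (a + b)) * b⁻¹ = (a + b)⁻¹ := by field_simp
  rw [smul_smul, smul_smul, h1, h2, smul_add]

theorem brunnMinkowskiMul_volume : BrunnMinkowskiMul
    (volume : Measure (EuclideanSpace ℝ (Fin n))) :=
  (brunnMinkowskiMul_volume_pi n).of_equiv (EuclideanSpace.equiv (Fin n) ℝ)

/-- The Brunn–Minkowski inequality for convex bodies. -/
theorem volumeRoot_add_le (hn : 1 ≤ n) (K L : ConvexBody (EuclideanSpace ℝ (Fin n))) :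
    volumeRoot K + volumeRoot L ≤ volumeRoot (K + L) := by
  rcases (volumeRoot_nonneg K).eq_or_lt' with hK | hK
  · rw [hK, zero_add, add_comm]; exact volumeRoot_le_add L K
  rcases (volumeRoot_nonneg L).eq_or_lt' with hL | hL
  · rw [hL, add_zero]; exact volumeRoot_le_add K L
  set a := volumeRoot K
  set b := volumeRoot L
  have h := brunnMinkowskiMul_volume (a⁻¹ • (K : Set (EuclideanSpace ℝ (Fin n))))
    (b⁻¹ • (L : Set (EuclideanSpace ℝ (Fin n)))) (K.isCompact.smul _) (K.convex.smul _)
    K.nonempty.smul_set (L.isCompact.smul _) (L.convex.smul _) L.nonempty.smul_set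
    (b / (a + b)) (by positivity) ((div_lt_one (by positivity)).2 (by linarith))
  rw [real_inv_volumeRoot_smul hn hK, real_inv_volumeRoot_smul hn hL, Real.one_rpow, Real.one_rpow, mul_one,
    normalized_combination hK hL, ← ConvexBody.coe_add, real_smul_body _ (by positivity),
    ← volumeRoot_pow hn, ← mul_pow] at h
  have h2 := (one_le_pow_iff_of_nonneg (mul_nonneg (by positivity) (volumeRoot_nonneg _))
    (by omega)).1 h
  rwa [le_inv_mul_iff₀ (by positivity), mul_one] at h2

/-- The equality case of the Brunn–Minkowski inequality for convex bodies of positive volume. -/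
theorem eq_smul_add_of_volumeRoot_add_eq (hn : 1 ≤ n)
    {K L : ConvexBody (EuclideanSpace ℝ (Fin n))}
    (hK : 0 < volumeRoot K) (hL : 0 < volumeRoot L)
    (h : volumeRoot (K + L) ≤ volumeRoot K + volumeRoot L) :
    ∃ v, (L : Set (EuclideanSpace ℝ (Fin n))) =
      (volumeRoot L / volumeRoot K) • (K : Set (EuclideanSpace ℝ (Fin n))) + {v} := by
  set a := volumeRoot K
  set b := volumeRoot L
  obtain ⟨v, hv⟩ := eq_translate_of_brunnMinkowski_eq (μ := volume)
    (K := a⁻¹ • (K : Set (EuclideanSpace ℝ (Fin n))))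
    (L := b⁻¹ • (L : Set (EuclideanSpace ℝ (Fin n)))) (K.isCompact.smul _) (K.convex.smul _)
    (L.isCompact.smul _) (L.convex.smul _)
    (l := b / (a + b)) (by positivity) ((div_lt_one (by positivity)).2 (by linarith))
    (by rw [real_inv_volumeRoot_smul hn hK]; exact one_pos) (by rw [real_inv_volumeRoot_smul hn hK, real_inv_volumeRoot_smul hn hL])
    (by
      rw [real_inv_volumeRoot_smul hn hK, normalized_combination hK hL, ← ConvexBody.coe_add,
        real_smul_body _ (by positivity), ← volumeRoot_pow hn, ← mul_pow]
      refine pow_le_one₀ (mul_nonneg (by positivity) (volumeRoot_nonneg _)) ?_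
      rwa [inv_mul_le_iff₀ (by positivity), mul_one])
  refine ⟨b • v, ?_⟩
  have h2 := congrArg (fun S => b • S) hv
  simp only [smul_add, smul_smul, mul_inv_cancel₀ hL.ne', one_smul, smul_set_singleton] at h2
  rw [h2, div_eq_mul_inv]

end additive

/-! ### Support functions. -/

section support

variable {n : ℕ} {K L : Set (EuclideanSpace ℝ (Fin n))}

theorem bddAbove_inner_image (hK : IsCompact K) (ξ : EuclideanSpace ℝ (Fin n)) :
    BddAbove ((fun ζ => inner ℝ ζ ξ) '' K) :=
  (hK.image (by fun_prop : Continuous fun ζ : EuclideanSpace ℝ (Fin n) => inner ℝ ζ ξ)).bddAbove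

theorem inner_le_supportFn (hK : IsCompact K) {x : EuclideanSpace ℝ (Fin n)} (hx : x ∈ K)
    (ξ : EuclideanSpace ℝ (Fin n)) : inner ℝ x ξ ≤ supportFn K ξ :=
  le_csSup (bddAbove_inner_image hK ξ) ⟨x, hx, rfl⟩

theorem supportFn_le (hK : K.Nonempty) {ξ : EuclideanSpace ℝ (Fin n)} {c : ℝ}
    (h : ∀ x ∈ K, inner ℝ x ξ ≤ c) : supportFn K ξ ≤ c :=
  csSup_le (hK.image _) (by rintro _ ⟨x, hx, rfl⟩; exact h x hx)

theorem mem_iff_forall_inner_le_supportFn (hK : IsCompact K) (hKc : Convex ℝ K)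
    (hKn : K.Nonempty) {x : EuclideanSpace ℝ (Fin n)} :
    x ∈ K ↔ ∀ ξ, inner ℝ x ξ ≤ supportFn K ξ := by
  refine ⟨fun hx ξ => inner_le_supportFn hK hx ξ, fun h => ?_⟩
  by_contra hx
  obtain ⟨f, u, hfK, hfx⟩ := geometric_hahn_banach_closed_point hKc hK.isClosed hx
  set ξ := (toDual ℝ (EuclideanSpace ℝ (Fin n))).symm f with hξ
  have hf : ∀ y, f y = inner ℝ y ξ := fun y => by
    rw [real_inner_comm, hξ, toDual_symm_apply]
  have h1 : supportFn K ξ ≤ u := supportFn_le hKn fun y hy => by rw [← hf]; exact (hfK y hy).le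
  have h2 := h ξ
  rw [← hf] at h2
  linarith

theorem subset_iff_supportFn_le (hK : IsCompact K) (hKn : K.Nonempty) (hL : IsCompact L)
    (hLc : Convex ℝ L) (hLn : L.Nonempty) :
    K ⊆ L ↔ ∀ ξ, supportFn K ξ ≤ supportFn L ξ := by
  refine ⟨fun h ξ => supportFn_le hKn fun x hx => inner_le_supportFn hL (h hx) ξ, fun h x hx => ?_⟩
  rw [mem_iff_forall_inner_le_supportFn hL hLc hLn]
  exact fun ξ => (inner_le_supportFn hK hx ξ).trans (h ξ)

theorem supportFn_add (hK : IsCompact K) (hKn : K.Nonempty) (hL : IsCompact L)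
    (hLn : L.Nonempty) (ξ : EuclideanSpace ℝ (Fin n)) :
    supportFn (K + L) ξ = supportFn K ξ + supportFn L ξ := by
  rw [supportFn, supportFn, supportFn, ← csSup_add (hKn.image _) (bddAbove_inner_image hK ξ)
    (hLn.image _) (bddAbove_inner_image hL ξ)]
  congr 1
  exact image_add (innerₛₗ ℝ |>.flip ξ)

theorem supportFn_smul {c : ℝ} (hc : 0 ≤ c) (K : Set (EuclideanSpace ℝ (Fin n)))
    (ξ : EuclideanSpace ℝ (Fin n)) : supportFn (c • K) ξ = c * supportFn K ξ := by
  rw [supportFn, supportFn, ← smul_eq_mul, ← Real.sSup_smul_of_nonneg hc]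
  congr 1
  exact image_smul_set (innerₛₗ ℝ |>.flip ξ) c K

theorem supportFn_singleton (v ξ : EuclideanSpace ℝ (Fin n)) :
    supportFn {v} ξ = inner ℝ v ξ := by
  simp [supportFn]

theorem supportFn_smul_right {c : ℝ} (hc : 0 ≤ c) (K : Set (EuclideanSpace ℝ (Fin n)))
    (ξ : EuclideanSpace ℝ (Fin n)) : supportFn K (c • ξ) = c * supportFn K ξ := by
  rw [← supportFn_smul hc, supportFn, supportFn, ← image_smul, image_image]
  simp only [inner_smul_left, inner_smul_right]
  rfl

theorem supportFn_add_right_le (hK : IsCompact K) (hKn : K.Nonempty)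
    (ξ η : EuclideanSpace ℝ (Fin n)) :
    supportFn K (ξ + η) ≤ supportFn K ξ + supportFn K η := by
  refine supportFn_le hKn fun x hx => ?_
  rw [inner_add_right]
  exact add_le_add (inner_le_supportFn hK hx ξ) (inner_le_supportFn hK hx η)

/-- The support function of the set defined by a sublinear function is that function. -/
theorem exists_mem_setOfSupportFn_inner_eq {h : EuclideanSpace ℝ (Fin n) → ℝ}
    (hadd : ∀ ξ η, h (ξ + η) ≤ h ξ + h η) (hsmul : ∀ c : ℝ, 0 < c → ∀ ξ, h (c • ξ) = c * h ξ)
    (ξ₀ : EuclideanSpace ℝ (Fin n)) : ∃ ζ ∈ setOfSupportFn h, inner ℝ ζ ξ₀ = h ξ₀ := by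
  have h0 : h 0 = 0 := by
    have := hsmul 2 two_pos 0
    rw [smul_zero] at this; linarith
  have hsum : ∀ ξ, 0 ≤ h ξ + h (-ξ) := fun ξ => by
    have := hadd ξ (-ξ); rwa [add_neg_cancel, h0] at this
  have H : ∀ c : ℝ, c • ξ₀ = 0 → RingHom.id ℝ c • h ξ₀ = 0 := fun c hc => by
    rcases smul_eq_zero.1 hc with rfl | rfl
    · simp
    · simp [h0]
  obtain ⟨g, hgf, hg⟩ := exists_extension_of_le_sublinear
    (LinearPMap.mkSpanSingleton' ξ₀ (h ξ₀) H) h hsmul hadd (fun x => by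
      obtain ⟨x, hx⟩ := x
      obtain ⟨c, rfl⟩ := Submodule.mem_span_singleton.1 hx
      rw [LinearPMap.mkSpanSingleton'_apply, smul_eq_mul, RingHom.id_apply]
      -- The linear functional on the line through ξ₀ is dominated by h; for negative multiples this
      -- uses 0 ≤ h(η) + h(-η).
      rcases lt_trichotomy c 0 with hc | rfl | hc
      · have h1 := hsmul (-c) (by linarith) ξ₀
        have h2 := hsum (c • ξ₀)
        rw [← neg_smul, h1] at h2
        linarith
      · simp [h0]
      · rw [hsmul c hc])
  refine ⟨(toDual ℝ _).symm g.toContinuousLinearMap, fun ξ => ?_, ?_⟩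
  · rw [toDual_symm_apply]; exact hg ξ
  · rw [toDual_symm_apply]
    exact (hgf ⟨ξ₀, Submodule.mem_span_singleton_self ξ₀⟩).trans
      (LinearPMap.mkSpanSingleton'_apply_self _ _ _ _)

end support

/-! ### Hausdorff distance, and continuity of the volume root. -/

section bodies

variable {n : ℕ}

/-- The closed unit ball as a convex body. -/
def unitBallBody (n : ℕ) : ConvexBody (EuclideanSpace ℝ (Fin n)) :=
  ⟨Metric.closedBall 0 1, convex_closedBall 0 1, isCompact_closedBall 0 1, Metric.nonempty_closedBall.2 zero_le_one⟩

theorem mem_unitBallBody {x : EuclideanSpace ℝ (Fin n)} :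
    x ∈ (unitBallBody n : Set (EuclideanSpace ℝ (Fin n))) ↔ ‖x‖ ≤ 1 :=
  mem_closedBall_zero_iff

theorem supportFn_unitBallBody (ξ : EuclideanSpace ℝ (Fin n)) :
    supportFn (unitBallBody n : Set (EuclideanSpace ℝ (Fin n))) ξ = ‖ξ‖ := by
  refine le_antisymm (supportFn_le (unitBallBody n).nonempty fun x hx => ?_) ?_
  · have hx1 : ‖x‖ ≤ 1 := mem_unitBallBody.1 hx
    calc inner ℝ x ξ ≤ ‖x‖ * ‖ξ‖ := real_inner_le_norm x ξ
      _ ≤ 1 * ‖ξ‖ := by gcongr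
      _ = ‖ξ‖ := one_mul _
  · rcases eq_or_ne ξ 0 with rfl | hξ
    · have := inner_le_supportFn (unitBallBody n).isCompact
        (x := 0) (mem_unitBallBody.2 (by simp)) 0
      simpa using this
    · have h0 : ‖ξ‖ ≠ 0 := norm_ne_zero_iff.2 hξ
      have := inner_le_supportFn (unitBallBody n).isCompact (x := ‖ξ‖⁻¹ • ξ)
        (mem_unitBallBody.2 (by simp [norm_smul, h0])) ξ
      rwa [inner_smul_left, real_inner_self_eq_norm_sq, conj_trivial, sq, ← mul_assoc,
        inv_mul_cancel₀ h0, one_mul] at this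

variable {K L M : ConvexBody (EuclideanSpace ℝ (Fin n))}

theorem ConvexBody.supportFn_add (K L : ConvexBody (EuclideanSpace ℝ (Fin n)))
    (ξ : EuclideanSpace ℝ (Fin n)) : supportFn (↑(K + L) : Set (EuclideanSpace ℝ (Fin n))) ξ =
      supportFn (K : Set (EuclideanSpace ℝ (Fin n))) ξ +
        supportFn (L : Set (EuclideanSpace ℝ (Fin n))) ξ := by
  rw [ConvexBody.coe_add, _root_.supportFn_add K.isCompact K.nonempty L.isCompact L.nonempty]

theorem ConvexBody.supportFn_smul {c : ℝ} (hc : 0 ≤ c)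
    (K : ConvexBody (EuclideanSpace ℝ (Fin n)))
    (ξ : EuclideanSpace ℝ (Fin n)) : supportFn (↑(c • K) : Set (EuclideanSpace ℝ (Fin n))) ξ =
      c * supportFn (K : Set (EuclideanSpace ℝ (Fin n))) ξ := by
  rw [ConvexBody.coe_smul, _root_.supportFn_smul hc]

theorem ConvexBody.subset_iff_supportFn_le :
    (K : Set (EuclideanSpace ℝ (Fin n))) ⊆ L ↔
      ∀ ξ, supportFn (K : Set (EuclideanSpace ℝ (Fin n))) ξ ≤ supportFn (L : Set _) ξ :=
  _root_.subset_iff_supportFn_le K.isCompact K.nonempty L.isCompact L.convex L.nonempty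

theorem subset_add_smul_unitBallBody {δ : ℝ} (hδ : 0 ≤ δ)
    (h : ∀ ξ, supportFn (K : Set (EuclideanSpace ℝ (Fin n))) ξ ≤ supportFn (L : Set _) ξ + δ * ‖ξ‖) :
    (K : Set (EuclideanSpace ℝ (Fin n))) ⊆ ↑(L + δ • unitBallBody n) := by
  rw [ConvexBody.subset_iff_supportFn_le]
  intro ξ
  rw [ConvexBody.supportFn_add, ConvexBody.supportFn_smul hδ, supportFn_unitBallBody]
  exact h ξ

theorem supportFn_le_add_dist (K L : ConvexBody (EuclideanSpace ℝ (Fin n)))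
    (ξ : EuclideanSpace ℝ (Fin n)) : supportFn (K : Set (EuclideanSpace ℝ (Fin n))) ξ ≤
      supportFn (L : Set (EuclideanSpace ℝ (Fin n))) ξ + dist K L * ‖ξ‖ := by
  refine supportFn_le K.nonempty fun x hx => ?_
  obtain ⟨y, hy, hxy⟩ := L.isCompact.exists_infDist_eq_dist L.nonempty x
  have h1 : dist x y ≤ dist K L := by
    rw [← hxy]
    exact Metric.infDist_le_hausdorffDist_of_mem hx ConvexBody.hausdorffEDist_ne_top
  have h2 : inner ℝ x ξ = inner ℝ y ξ + inner ℝ (x - y) ξ := by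
    rw [← inner_add_left]; congr 1; abel
  rw [h2]
  refine add_le_add (inner_le_supportFn L.isCompact hy ξ) ((real_inner_le_norm _ _).trans ?_)
  rw [← dist_eq_norm]
  gcongr

theorem abs_supportFn_sub_le (K L : ConvexBody (EuclideanSpace ℝ (Fin n)))
    (ξ : EuclideanSpace ℝ (Fin n)) : |supportFn (K : Set (EuclideanSpace ℝ (Fin n))) ξ -
      supportFn (L : Set (EuclideanSpace ℝ (Fin n))) ξ| ≤ dist K L * ‖ξ‖ := by
  rw [abs_sub_le_iff]
  have h1 := supportFn_le_add_dist K L ξ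
  have h2 := supportFn_le_add_dist L K ξ
  rw [dist_comm] at h2
  constructor <;> linarith

theorem exists_dist_le_of_supportFn_le {δ : ℝ} (hδ : 0 ≤ δ)
    (h : ∀ ξ, supportFn (K : Set (EuclideanSpace ℝ (Fin n))) ξ ≤ supportFn (L : Set _) ξ + δ * ‖ξ‖) :
    ∀ x ∈ (K : Set (EuclideanSpace ℝ (Fin n))), ∃ y ∈ (L : Set _), dist x y ≤ δ := by
  intro x hx
  obtain ⟨y, hy, _, ⟨b, hb, rfl⟩, rfl⟩ := subset_add_smul_unitBallBody hδ h hx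
  refine ⟨y, hy, ?_⟩
  have hb1 : ‖b‖ ≤ 1 := mem_unitBallBody.1 hb
  change dist (y + δ • b) y ≤ δ
  rw [dist_eq_norm, add_sub_cancel_left, norm_smul, Real.norm_eq_abs, abs_of_nonneg hδ]
  exact mul_le_of_le_one_right hδ hb1

theorem dist_le_of_abs_supportFn_sub_le {δ : ℝ} (hδ : 0 ≤ δ)
    (h : ∀ ξ, |supportFn (K : Set (EuclideanSpace ℝ (Fin n))) ξ - supportFn (L : Set _) ξ| ≤
      δ * ‖ξ‖) : dist K L ≤ δ := by
  refine Metric.hausdorffDist_le_of_mem_dist hδ ?_ ?_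
  · exact exists_dist_le_of_supportFn_le hδ fun ξ => by have := (abs_sub_le_iff.1 (h ξ)).1; linarith
  · exact exists_dist_le_of_supportFn_le hδ fun ξ => by have := (abs_sub_le_iff.1 (h ξ)).2; linarith

theorem dist_add_smul_unitBallBody_le {δ : ℝ} (hδ : 0 ≤ δ) :
    dist (K + δ • unitBallBody n) K ≤ δ := by
  refine dist_le_of_abs_supportFn_sub_le hδ fun ξ => ?_
  rw [ConvexBody.supportFn_add, ConvexBody.supportFn_smul hδ, supportFn_unitBallBody,
    add_sub_cancel_left, abs_of_nonneg (by positivity)]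

/-- K + δB is the closed δ-thickening of K, and the volumes of these thickenings tend to that of the
closed set K. -/
theorem tendsto_volumeRoot_add_smul_unitBallBody (K : ConvexBody (EuclideanSpace ℝ (Fin n))) :
    Filter.Tendsto (fun δ : ℝ => volumeRoot (K + δ • unitBallBody n)) (nhdsWithin 0 (Ioi 0))
      (nhds (volumeRoot K)) := by
  have h1 : Filter.Tendsto (fun r => volume (Metric.cthickening r (K : Set (EuclideanSpace ℝ (Fin n)))))
      (nhdsWithin 0 (Ioi 0)) (nhds (volume (K : Set (EuclideanSpace ℝ (Fin n))))) :=
    (tendsto_measure_cthickening_of_isClosed ⟨1, one_pos,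
      (K.isBounded.cthickening (δ := 1)).measure_lt_top.ne⟩ K.isClosed).mono_left nhdsWithin_le_nhds
  have h2 := ((ENNReal.tendsto_toReal K.isCompact.measure_ne_top).comp h1).rpow_const
    (p := (1 : ℝ) / n) (Or.inr (by positivity))
  refine h2.congr' ?_
  filter_upwards [self_mem_nhdsWithin] with δ hδ
  have hδ' : 0 < δ := hδ
  rw [volumeRoot, Function.comp, ConvexBody.coe_add, ConvexBody.coe_smul,
    ← K.isCompact.add_closedBall_zero hδ'.le]
  have : δ • (unitBallBody n : Set (EuclideanSpace ℝ (Fin n))) = Metric.closedBall 0 δ := by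
    change δ • Metric.closedBall (0 : EuclideanSpace ℝ (Fin n)) 1 = _
    rw [smul_closedBall _ _ zero_le_one, smul_zero, Real.norm_eq_abs, abs_of_pos hδ', mul_one]
  rw [this]; rfl

/-- The inner ball gives h_K(ξ) ≥ p·ξ + r‖ξ‖. Shrinking K towards p by the factor 1 - δ/r lowers h_K
by at least δ‖ξ‖, which puts the shrunken copy inside L. -/
theorem smul_volumeRoot_le_of_dist_le (hn : 1 ≤ n) {p : EuclideanSpace ℝ (Fin n)} {r δ : ℝ}
    (hr : 0 < r) (hK : Metric.closedBall p r ⊆ (K : Set (EuclideanSpace ℝ (Fin n))))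
    (hd : dist K L ≤ δ) (hδr : δ ≤ r) : (1 - δ / r) * volumeRoot K ≤ volumeRoot L := by
  have hδ : 0 ≤ δ := dist_nonneg.trans hd
  have hc : 0 ≤ 1 - δ / r := by rw [sub_nonneg, div_le_one hr]; exact hδr
  have hpK : ∀ ξ, inner ℝ p ξ + r * ‖ξ‖ ≤ supportFn (K : Set (EuclideanSpace ℝ (Fin n))) ξ := by
    intro ξ
    have hsub : ({p} + r • (unitBallBody n : Set (EuclideanSpace ℝ (Fin n)))) ⊆ K := by
      refine Subset.trans ?_ hK
      rintro _ ⟨_, rfl, _, ⟨b, hb, rfl⟩, rfl⟩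
      have hb1 : ‖b‖ ≤ 1 := mem_unitBallBody.1 hb
      simp only [Metric.mem_closedBall, dist_self_add_left, norm_smul, Real.norm_eq_abs,
        abs_of_pos hr]
      exact mul_le_of_le_one_right hr.le hb1
    have hcpt := (unitBallBody n).isCompact.smul r
    have hne := (unitBallBody n).nonempty.smul_set (a := r)
    have h := (subset_iff_supportFn_le (isCompact_singleton.add hcpt)
      ((singleton_nonempty p).add hne) K.isCompact K.convex K.nonempty).1 hsub ξ
    rwa [supportFn_add isCompact_singleton (singleton_nonempty p) hcpt hne, supportFn_singleton,
      supportFn_smul hr.le, supportFn_unitBallBody] at h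
  have hcpt := K.isCompact.smul (1 - δ / r)
  have hne := K.nonempty.smul_set (a := 1 - δ / r)
  have hsub : ((1 - δ / r) • (K : Set (EuclideanSpace ℝ (Fin n))) + {(δ / r) • p}) ⊆ L := by
    rw [subset_iff_supportFn_le (hcpt.add isCompact_singleton) (hne.add (singleton_nonempty _))
      L.isCompact L.convex L.nonempty]
    intro ξ
    rw [supportFn_add hcpt hne isCompact_singleton (singleton_nonempty _), supportFn_singleton,
      supportFn_smul hc, inner_smul_left, conj_trivial]
    have h1 := supportFn_le_add_dist K L ξ
    have h2 := mul_le_mul_of_nonneg_left (hpK ξ) (div_nonneg hδ hr.le)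
    have h3 : δ / r * (inner ℝ p ξ + r * ‖ξ‖) = δ / r * inner ℝ p ξ + δ * ‖ξ‖ := by
      field_simp
    have h4 : dist K L * ‖ξ‖ ≤ δ * ‖ξ‖ := by gcongr
    linarith
  rw [← volumeRoot_smul hn hc, volumeRoot, volumeRoot, ConvexBody.coe_smul,
    ← real_add_singleton _ ((δ / r) • p)]
  exact Real.rpow_le_rpow measureReal_nonneg (measureReal_mono hsub L.isCompact.measure_ne_top)
    (by positivity)

/-- The root of the volume is continuous for the Hausdorff metric. -/
theorem continuous_volumeRoot (hn : 1 ≤ n) :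
    Continuous (volumeRoot : ConvexBody (EuclideanSpace ℝ (Fin n)) → ℝ) := by
  rw [Metric.continuous_iff]
  intro K ε hε
  have hup : ∃ δ > 0, ∀ L, dist L K < δ → volumeRoot L < volumeRoot K + ε := by
    have h := (tendsto_volumeRoot_add_smul_unitBallBody K).eventually_lt_const
      (lt_add_of_pos_right _ hε)
    obtain ⟨δ, hδ, hδ0⟩ := (h.and self_mem_nhdsWithin).exists
    refine ⟨δ, hδ0, fun L hL => lt_of_le_of_lt (volumeRoot_mono ?_) hδ⟩
    refine subset_add_smul_unitBallBody (le_of_lt hδ0) fun ξ => ?_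
    have := supportFn_le_add_dist L K ξ
    have : dist L K * ‖ξ‖ ≤ δ * ‖ξ‖ := by gcongr
    linarith
  have hlow : ∃ δ > 0, ∀ L, dist L K < δ → volumeRoot K - ε < volumeRoot L := by
    rcases (volumeRoot_nonneg K).eq_or_lt' with h0 | h0
    · exact ⟨1, one_pos, fun L _ => by have := volumeRoot_nonneg L; linarith⟩
    have hv : 0 < volume.real (K : Set (EuclideanSpace ℝ (Fin n))) := by
      rw [← volumeRoot_pow hn]; positivity
    obtain ⟨p, hp⟩ := interior_nonempty_of_measureReal_pos K.convex hv
    obtain ⟨r, hr, hrK⟩ := Metric.nhds_basis_closedBall.mem_iff.1 (mem_interior_iff_mem_nhds.1 hp)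
    -- Chosen so that the loss (δ/r) V(K) is at most ε/2.
    set δ := min r (r * ε / (2 * volumeRoot K)) with hδ
    have hδ0 : 0 < δ := lt_min hr (by positivity)
    refine ⟨δ, hδ0, fun L hL => ?_⟩
    have h := smul_volumeRoot_le_of_dist_le hn hr hrK (dist_comm L K ▸ hL.le) (min_le_left _ _)
    have h2 : δ / r * volumeRoot K ≤ ε / 2 := by
      have : δ ≤ r * ε / (2 * volumeRoot K) := min_le_right _ _
      rw [le_div_iff₀ (by positivity)] at this
      rw [div_mul_eq_mul_div, div_le_iff₀ hr]
      linarith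
    linarith
  obtain ⟨δ₁, h1, h1'⟩ := hup
  obtain ⟨δ₂, h2, h2'⟩ := hlow
  refine ⟨min δ₁ δ₂, lt_min h1 h2, fun L hL => ?_⟩
  have a := h1' L (hL.trans_le (min_le_left _ _))
  have b := h2' L (hL.trans_le (min_le_right _ _))
  rw [Real.dist_eq, abs_sub_lt_iff]
  constructor <;> linarith

theorem supportFn_sum {ι : Type*} (s : Finset ι) {w : ι → ℝ} (hw : ∀ i, 0 ≤ w i)
    (K : ι → ConvexBody (EuclideanSpace ℝ (Fin n))) (ξ : EuclideanSpace ℝ (Fin n)) :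
    supportFn (↑(∑ i ∈ s, w i • K i) : Set (EuclideanSpace ℝ (Fin n))) ξ =
      ∑ i ∈ s, w i * supportFn (K i : Set (EuclideanSpace ℝ (Fin n))) ξ := by
  classical
  induction s using Finset.induction_on with
  | empty =>
    simp only [Finset.sum_empty, ConvexBody.coe_zero]
    exact (supportFn_singleton 0 ξ).trans (inner_zero_left _)
  | insert i s hi ih =>
    rw [Finset.sum_insert hi, Finset.sum_insert hi, ConvexBody.supportFn_add,
      ConvexBody.supportFn_smul (hw i), ih]

theorem sum_volumeRoot_le (hn : 1 ≤ n) {ι : Type*} (s : Finset ι) {w : ι → ℝ} (hw : ∀ i, 0 ≤ w i)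
    (K : ι → ConvexBody (EuclideanSpace ℝ (Fin n))) :
    ∑ i ∈ s, w i * volumeRoot (K i) ≤ volumeRoot (∑ i ∈ s, w i • K i) := by
  classical
  induction s using Finset.induction_on with
  | empty => simpa using volumeRoot_nonneg _
  | insert i s hi ih =>
    rw [Finset.sum_insert hi, Finset.sum_insert hi, ← volumeRoot_smul hn (hw i)]
    exact (add_le_add_right ih _).trans (volumeRoot_add_le hn _ _)

end bodies

/-! ### Brunn–Minkowski for Minkowski integrals. -/

theorem integral_comp_simpleFunc {X Y : Type*} [MeasurableSpace X] {μ : Measure X}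
    [IsFiniteMeasure μ] (s : SimpleFunc X Y) (g : Y → ℝ) :
    ∫ y, g (s y) ∂μ = ∑ v ∈ s.range, μ.real (s ⁻¹' {v}) * g v := by
  have h : ∀ y, g (s y) = ∑ v ∈ s.range, (s ⁻¹' {v}).indicator (fun _ => g v) y := by
    intro y
    rw [Finset.sum_eq_single (s y)]
    · rw [indicator_of_mem (show y ∈ s ⁻¹' {s y} from rfl)]
    · intro v _ hv
      exact indicator_of_notMem (fun h => hv h.symm) _
    · intro h; exact absurd (s.mem_range_self y) h
  simp_rw [h]
  rw [integral_finsetSum]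
  · refine Finset.sum_congr rfl fun v _ => ?_
    rw [integral_indicator_const _ (s.measurableSet_fiber v), smul_eq_mul]
  · intro v _
    exact (integrable_const _).indicator (s.measurableSet_fiber v)

section

variable {n : ℕ}

theorem continuous_supportFn_body (ξ : EuclideanSpace ℝ (Fin n)) :
    Continuous fun K : ConvexBody (EuclideanSpace ℝ (Fin n)) =>
      supportFn (K : Set (EuclideanSpace ℝ (Fin n))) ξ := by
  refine (LipschitzWith.of_dist_le_mul (K := ‖ξ‖₊) fun K L => ?_).continuous
  rw [Real.dist_eq, mul_comm, coe_nnnorm]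
  exact abs_supportFn_sub_le K L ξ

/-- The Brunn–Minkowski inequality for the Minkowski integral of a continuous family of convex
bodies. -/
theorem integral_volumeRoot_le (hn : 1 ≤ n) {X : Type*} [MetricSpace X]
    [SecondCountableTopology X] [MeasurableSpace X] [BorelSpace X] {μ : Measure X}
    [IsProbabilityMeasure μ] {S : Set X} (hS : IsCompact S) (hμS : ∀ᵐ y ∂μ, y ∈ S)
    {K : X → ConvexBody (EuclideanSpace ℝ (Fin n))} (hK : ContinuousOn K S)
    {C : ConvexBody (EuclideanSpace ℝ (Fin n))}
    (hC : ∀ ξ, ∫ y, supportFn (K y : Set (EuclideanSpace ℝ (Fin n))) ξ ∂μ ≤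
      supportFn (C : Set (EuclideanSpace ℝ (Fin n))) ξ) :
    ∫ y, volumeRoot (K y) ∂μ ≤ volumeRoot C := by
  obtain ⟨y₀, hy₀⟩ := hμS.exists
  -- Simple functions with values in S approximate the identity, so K ∘ s j takes finitely many
  -- values and the finite Brunn–Minkowski inequality applies.
  set s : ℕ → SimpleFunc X X := fun j => SimpleFunc.approxOn id measurable_id S y₀ hy₀ j with hs
  have hsS : ∀ j y, s j y ∈ S := fun j y => SimpleFunc.approxOn_mem measurable_id hy₀ j y
  have hst : ∀ y ∈ S, Filter.Tendsto (fun j => s j y) Filter.atTop (nhds y) := fun y hy =>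
    SimpleFunc.tendsto_approxOn measurable_id hy₀ (subset_closure hy)
  have hKt : ∀ y ∈ S, Filter.Tendsto (fun j => K (s j y)) Filter.atTop (nhds (K y)) := by
    intro y hy
    refine (hK y hy).tendsto.comp (tendsto_nhdsWithin_iff.2 ⟨hst y hy, ?_⟩)
    exact .of_forall fun j => hsS j y
  have hrestr : μ.restrict S = μ := Measure.restrict_eq_self_of_ae_mem hμS
  have hmeas : ∀ g : ConvexBody (EuclideanSpace ℝ (Fin n)) → ℝ, Continuous g →
      AEStronglyMeasurable (fun y => g (K y)) μ := by
    intro g hg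
    rw [← hrestr]
    exact (hg.comp_continuousOn hK).aestronglyMeasurable hS.measurableSet
  have hmeass : ∀ j, ∀ g : X → ℝ, AEStronglyMeasurable (fun y => g (s j y)) μ := fun j g =>
    ((s j).map g).aestronglyMeasurable
  have hbound : ∀ g : ConvexBody (EuclideanSpace ℝ (Fin n)) → ℝ, Continuous g →
      ∃ B, ∀ y ∈ S, ‖g (K y)‖ ≤ B := fun g hg =>
    hS.exists_bound_of_continuousOn (hg.comp_continuousOn hK)
  have hint : ∀ g : ConvexBody (EuclideanSpace ℝ (Fin n)) → ℝ, Continuous g →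
      Integrable (fun y => g (K y)) μ := by
    intro g hg
    obtain ⟨B, hB⟩ := hbound g hg
    exact .of_bound (hmeas g hg) B (hμS.mono hB)
  have hints : ∀ j, ∀ g : ConvexBody (EuclideanSpace ℝ (Fin n)) → ℝ, Continuous g →
      Integrable (fun y => g (K (s j y))) μ := by
    intro j g hg
    obtain ⟨B, hB⟩ := hbound g hg
    exact .of_bound (hmeass j fun x => g (K x)) B (.of_forall fun y => hB _ (hsS j y))
  have hdbound : ∃ B, ∀ y ∈ S, ∀ z ∈ S, dist (K z) (K y) ≤ B := by
    obtain ⟨B, hB⟩ := (Metric.isBounded_iff.1 (hS.image_of_continuousOn hK).isBounded)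
    exact ⟨B, fun y hy z hz => hB (mem_image_of_mem K hz) (mem_image_of_mem K hy)⟩
  obtain ⟨B, hB⟩ := hdbound
  have hdmeas : ∀ j, AEStronglyMeasurable (fun y => dist (K (s j y)) (K y)) μ := by
    intro j
    have h1 : AEStronglyMeasurable (fun y => K (s j y)) μ :=
      ((s j).map K).stronglyMeasurable.aestronglyMeasurable
    have h2 : AEStronglyMeasurable K μ := by
      rw [← hrestr]; exact hK.aestronglyMeasurable hS.measurableSet
    exact h1.dist h2
  have hdb : ∀ j, ∀ᵐ y ∂μ, ‖dist (K (s j y)) (K y)‖ ≤ B := fun j => hμS.mono fun y hy => by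
    rw [Real.norm_of_nonneg dist_nonneg]; exact hB y hy _ (hsS j y)
  have hdint : ∀ j, Integrable (fun y => dist (K (s j y)) (K y)) μ := fun j =>
    .of_bound (hdmeas j) B (hdb j)
  -- The mean Hausdorff error; enlarging C by a ball of this radius absorbs the error in every
  -- support function at once.
  set δ : ℕ → ℝ := fun j => ∫ y, dist (K (s j y)) (K y) ∂μ with hδ
  have hδ0 : ∀ j, 0 ≤ δ j := fun j => integral_nonneg fun y => dist_nonneg
  have hδt : Filter.Tendsto δ Filter.atTop (nhds 0) := by
    have := tendsto_integral_of_dominated_convergence (μ := μ)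
      (F := fun j y => dist (K (s j y)) (K y)) (f := fun _ => (0:ℝ)) (fun _ => B) hdmeas
      (integrable_const _) hdb (hμS.mono fun y hy => tendsto_iff_dist_tendsto_zero.1 (hKt y hy))
    simpa using this
  have hstep : ∀ j, ∫ y, volumeRoot (K (s j y)) ∂μ ≤ volumeRoot (C + δ j • unitBallBody n) := by
    intro j
    rw [integral_comp_simpleFunc (s j) (fun v => volumeRoot (K v))]
    refine (sum_volumeRoot_le hn _ (fun v => measureReal_nonneg) K).trans (volumeRoot_mono ?_)
    refine subset_add_smul_unitBallBody (hδ0 j) fun ξ => ?_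
    rw [supportFn_sum _ (fun v => measureReal_nonneg), ← integral_comp_simpleFunc (s j)
      (fun v => supportFn (K v : Set (EuclideanSpace ℝ (Fin n))) ξ)]
    refine le_trans ?_ (add_le_add_left (hC ξ) _)
    rw [hδ, ← integral_mul_const, ← integral_add (hint _ (continuous_supportFn_body ξ))
      ((hdint j).mul_const _)]
    exact integral_mono (hints j _ (continuous_supportFn_body ξ))
      ((hint _ (continuous_supportFn_body ξ)).add ((hdint j).mul_const _))
      fun y => supportFn_le_add_dist _ _ ξ
  have hVc := continuous_volumeRoot (n := n) hn
  have hlim1 : Filter.Tendsto (fun j => ∫ y, volumeRoot (K (s j y)) ∂μ) Filter.atTop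
      (nhds (∫ y, volumeRoot (K y) ∂μ)) := by
    obtain ⟨B, hB⟩ := hbound _ hVc
    exact tendsto_integral_of_dominated_convergence (fun _ => B)
      (fun j => hmeass j fun x => volumeRoot (K x))
      (integrable_const _) (fun j => .of_forall fun y => hB _ (hsS j y))
      (hμS.mono fun y hy => (hVc.tendsto _).comp (hKt y hy))
  have hlim2 : Filter.Tendsto (fun j => volumeRoot (C + δ j • unitBallBody n)) Filter.atTop
      (nhds (volumeRoot C)) := by
    refine (hVc.tendsto C).comp (tendsto_iff_dist_tendsto_zero.2 ?_)
    exact squeeze_zero (fun j => dist_nonneg)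
      (fun j => dist_add_smul_unitBallBody_le (hδ0 j)) hδt
  exact le_of_tendsto_of_tendsto' hlim1 hlim2 hstep

end

/-! ### A smooth radial weight and the Laplacian. -/

open scoped Laplacian

/-- A smooth nonincreasing cutoff, positive exactly on `(-∞, 1)`. -/
noncomputable def radialCutoff (t : ℝ) : ℝ := Real.smoothTransition (1 - t)

theorem contDiff_radialCutoff : ContDiff ℝ (⊤ : ℕ∞) radialCutoff :=
  Real.smoothTransition.contDiff.comp (contDiff_const.sub contDiff_id)

theorem radialCutoff_nonneg (t : ℝ) : 0 ≤ radialCutoff t := Real.smoothTransition.nonneg _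

theorem radialCutoff_pos {t : ℝ} (ht : t < 1) : 0 < radialCutoff t :=
  Real.smoothTransition.pos_of_pos (by linarith)

theorem radialCutoff_eq_zero {t : ℝ} (ht : 1 ≤ t) : radialCutoff t = 0 :=
  Real.smoothTransition.zero_of_nonpos (by linarith)

/-- Half the integral of `radialCutoff` over `[t, 1]`. -/
noncomputable def radialPrimitive (t : ℝ) : ℝ := (1 / 2) * ∫ s in t..1, radialCutoff s

theorem hasDerivAt_radialPrimitive (t : ℝ) :
    HasDerivAt radialPrimitive (-(1 / 2) * radialCutoff t) t := by
  have hc := contDiff_radialCutoff.continuous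
  have := (intervalIntegral.integral_hasDerivAt_left (hc.intervalIntegrable t 1)
    hc.aestronglyMeasurable.stronglyMeasurableAtFilter hc.continuousAt).const_mul (1 / 2)
  rw [show -(1 / 2) * radialCutoff t = 1 / 2 * -radialCutoff t by ring]
  exact this

theorem radialPrimitive_eq_zero {t : ℝ} (ht : 1 ≤ t) : radialPrimitive t = 0 := by
  have : ∫ s in t..1, radialCutoff s = ∫ s in t..1, (0 : ℝ) := by
    refine intervalIntegral.integral_congr fun s hs => radialCutoff_eq_zero ?_
    rw [uIcc_of_ge ht] at hs
    exact hs.1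
  rw [radialPrimitive, this]; simp

theorem radialPrimitive_pos {t : ℝ} (ht : t < 1) : 0 < radialPrimitive t := by
  refine mul_pos (by norm_num) (intervalIntegral.intervalIntegral_pos_of_pos_on
    (contDiff_radialCutoff.continuous.intervalIntegrable t 1) (fun s hs => radialCutoff_pos hs.2) ht)

section weights

variable {E : Type*} [NormedAddCommGroup E]

/-- A smooth radial weight supported in the closed unit ball. -/
noncomputable def ballWeight (y : E) : ℝ := radialCutoff (‖y‖ ^ 2)

/-- A radial function supported in the closed unit ball, whose gradient at `y` is
`-ballWeight y • y`. -/
noncomputable def ballPotential (y : E) : ℝ := radialPrimitive (‖y‖ ^ 2)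

theorem contDiff_ballWeight [InnerProductSpace ℝ E] : ContDiff ℝ (⊤ : ℕ∞) (ballWeight : E → ℝ) :=
  contDiff_radialCutoff.comp (contDiff_norm_sq ℝ)

theorem ballWeight_nonneg (y : E) : 0 ≤ ballWeight y := radialCutoff_nonneg _

theorem ballWeight_neg (y : E) : ballWeight (-y) = ballWeight y := by
  rw [ballWeight, norm_neg, ballWeight]

theorem ballWeight_pos {y : E} (hy : ‖y‖ < 1) : 0 < ballWeight y :=
  radialCutoff_pos (by rw [sq_lt_one_iff₀ (norm_nonneg y)]; exact hy)

theorem ballWeight_eq_zero {y : E} (hy : 1 ≤ ‖y‖) : ballWeight y = 0 :=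
  radialCutoff_eq_zero (one_le_pow₀ hy)

theorem ballPotential_eq_zero {y : E} (hy : 1 ≤ ‖y‖) : ballPotential y = 0 :=
  radialPrimitive_eq_zero (one_le_pow₀ hy)

theorem ballPotential_pos {y : E} (hy : ‖y‖ < 1) : 0 < ballPotential y :=
  radialPrimitive_pos (by rw [sq_lt_one_iff₀ (norm_nonneg y)]; exact hy)

theorem ballPotential_nonneg (y : E) : 0 ≤ ballPotential y := by
  rcases lt_or_ge ‖y‖ 1 with h | h
  · exact (ballPotential_pos h).le
  · exact (ballPotential_eq_zero h).ge

variable [InnerProductSpace ℝ E]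

theorem hasFDerivAt_ballPotential (y : E) :
    HasFDerivAt ballPotential (-ballWeight y • innerSL ℝ y) y := by
  have h := (hasDerivAt_radialPrimitive (‖y‖ ^ 2)).comp_hasFDerivAt y
    (hasStrictFDerivAt_norm_sq y).hasFDerivAt
  have e : -ballWeight y • innerSL ℝ y =
      (-(1 / 2) * radialCutoff (‖y‖ ^ 2)) • 2 • innerSL ℝ y := by
    ext z
    simp [ballWeight]
    ring
  rw [e]
  exact h

theorem continuous_ballPotential : Continuous (ballPotential : E → ℝ) :=
  continuous_iff_continuousAt.2 fun y => (hasFDerivAt_ballPotential y).continuousAt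

variable [FiniteDimensional ℝ E]

theorem hasCompactSupport_of_eq_zero_of_one_le_norm {G : Type*} [Zero G] {g : E → G}
    (h : ∀ y, 1 ≤ ‖y‖ → g y = 0) : HasCompactSupport g := by
  refine HasCompactSupport.intro (isCompact_closedBall (0 : E) 1) fun y hy => h y ?_
  rw [mem_closedBall_zero_iff, not_le] at hy
  exact hy.le

theorem hasCompactSupport_ballWeight : HasCompactSupport (ballWeight : E → ℝ) :=
  hasCompactSupport_of_eq_zero_of_one_le_norm fun _ => ballWeight_eq_zero

theorem hasCompactSupport_ballPotential : HasCompactSupport (ballPotential : E → ℝ) :=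
  hasCompactSupport_of_eq_zero_of_one_le_norm fun _ => ballPotential_eq_zero

variable [MeasurableSpace E] [BorelSpace E]

theorem integrable_ballWeight_smul {F : Type*} [NormedAddCommGroup F] [NormedSpace ℝ F]
    {g : E → F} (hg : Continuous g) : Integrable (fun y => ballWeight y • g y) :=
  (contDiff_ballWeight.continuous.smul hg).integrable_of_hasCompactSupport
    hasCompactSupport_ballWeight.smul_right

theorem integrable_ballPotential_smul {F : Type*} [NormedAddCommGroup F] [NormedSpace ℝ F]
    {g : E → F} (hg : Continuous g) : Integrable (fun y => ballPotential y • g y) :=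
  (continuous_ballPotential.smul hg).integrable_of_hasCompactSupport
    hasCompactSupport_ballPotential.smul_right

theorem integral_ballWeight_pos : 0 < ∫ y : E, ballWeight y := by
  have hc : Continuous (ballWeight : E → ℝ) := contDiff_ballWeight.continuous
  exact hc.integral_pos_of_hasCompactSupport_nonneg_nonzero hasCompactSupport_ballWeight
    ballWeight_nonneg (x := 0) (ballWeight_pos (by simp)).ne'

theorem integral_ballPotential_pos : 0 < ∫ y : E, ballPotential y :=
  continuous_ballPotential.integral_pos_of_hasCompactSupport_nonneg_nonzero
    hasCompactSupport_ballPotential ballPotential_nonneg (x := 0)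
    (ballPotential_pos (by simp)).ne'

section derivative

variable {F : Type*} [NormedAddCommGroup F] [NormedSpace ℝ F] {f : E → F}

theorem hasDerivAt_integral_ballWeight (hf : ContDiff ℝ 2 f) (x : E) (s : ℝ) :
    HasDerivAt (fun s : ℝ => ∫ y, ballWeight y • f (x + s • y))
      (∫ y, ballWeight y • fderiv ℝ f (x + s • y) y) s := by
  have hfd : Continuous (fderiv ℝ f) := hf.continuous_fderiv (by norm_num)
  have hcont : Continuous fun p : ℝ × E => ballWeight p.2 • fderiv ℝ f (x + p.1 • p.2) p.2 := by
    refine (contDiff_ballWeight.continuous.comp continuous_snd).smul ?_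
    exact (hfd.comp (by fun_prop)).clm_apply continuous_snd
  obtain ⟨B, hB⟩ := ((isCompact_Icc (a := s - 1) (b := s + 1)).prod
    -- The weight vanishes off the unit ball, so a bound on this compact set dominates the
    -- derivative for all parameters within distance one of s.
    (isCompact_closedBall (0 : E) 1)).exists_bound_of_continuousOn hcont.continuousOn
  have hslice : ∀ s : ℝ, Continuous fun y : E => f (x + s • y) := fun s =>
    hf.continuous.comp (by fun_prop)
  refine (hasDerivAt_integral_of_dominated_loc_of_deriv_le (Metric.ball_mem_nhds s one_pos)
    (F := fun s y => ballWeight y • f (x + s • y))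
    (F' := fun s y => ballWeight y • fderiv ℝ f (x + s • y) y)
    (bound := (Metric.closedBall (0 : E) 1).indicator fun _ => B) ?_ ?_ ?_ ?_ ?_ ?_).2
  · exact .of_forall fun s => (integrable_ballWeight_smul (hslice s)).1
  · exact integrable_ballWeight_smul (hslice s)
  · exact (hcont.comp (by fun_prop : Continuous fun y : E => (s, y))).aestronglyMeasurable
  · refine .of_forall fun y t ht => ?_
    by_cases hy : y ∈ Metric.closedBall (0 : E) 1
    · rw [indicator_of_mem hy]
      rw [Metric.mem_ball, Real.dist_eq, abs_sub_lt_iff] at ht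
      exact hB (t, y) ⟨⟨by linarith [ht.2], by linarith [ht.1]⟩, hy⟩
    · rw [indicator_of_notMem hy, ballWeight_eq_zero, zero_smul, norm_zero]
      rw [mem_closedBall_zero_iff, not_le] at hy
      exact hy.le
  · exact (integrable_indicator_iff measurableSet_closedBall).2
      (integrableOn_const (isCompact_closedBall (0 : E) 1).measure_ne_top)
  · refine .of_forall fun y t _ => ?_
    have h1 : HasDerivAt (fun t : ℝ => x + t • y) y t := by
      simpa using ((hasDerivAt_id t).smul_const y).const_add x
    have h2 := ((hf.differentiable (by norm_num)) (x + t • y)).hasFDerivAt.comp_hasDerivAt t h1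
    exact h2.const_smul (ballWeight y)

/-- The gradient of `ballPotential` at y is -`ballWeight` y • y. Integration by parts along an
orthonormal basis has no boundary term; the chain rule produces the factor s, and summing the second
derivatives gives the Laplacian. -/
theorem integral_ballWeight_fderiv (hf : ContDiff ℝ 2 f) (x : E) (s : ℝ) :
    ∫ y, ballWeight y • fderiv ℝ f (x + s • y) y = s • ∫ y, ballPotential y • (Δ f) (x + s • y) := by
  set b := stdOrthonormalBasis ℝ E
  have hfd : ContDiff ℝ 1 (fderiv ℝ f) := hf.fderiv_right (by norm_num)
  have hffd : Continuous (fderiv ℝ (fderiv ℝ f)) := hfd.continuous_fderiv (by norm_num)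
  have hg : ∀ i y, HasFDerivAt (fun y : E => fderiv ℝ f (x + s • y) (b i))
      (((fderiv ℝ (fderiv ℝ f) (x + s • y)).comp (s • ContinuousLinearMap.id ℝ E)).flip (b i)) y := by
    intro i y
    have h1 : HasFDerivAt (fun y : E => x + s • y) (s • ContinuousLinearMap.id ℝ E) y :=
      ((hasFDerivAt_id y).const_smul s).const_add x
    have h2 := ((hfd.differentiable (by norm_num)) (x + s • y)).hasFDerivAt.comp y h1
    have h3 := h2.clm_apply (hasFDerivAt_const (b i) y)
    simpa using h3
  have hgc : ∀ i, Continuous fun y : E => fderiv ℝ f (x + s • y) (b i) := fun i =>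
    (hfd.continuous.comp (by fun_prop)).clm_apply continuous_const
  have hgd : ∀ i y, fderiv ℝ (fun y : E => fderiv ℝ f (x + s • y) (b i)) y (b i) =
      s • fderiv ℝ (fderiv ℝ f) (x + s • y) (b i) (b i) := by
    intro i y
    rw [(hg i y).fderiv]; simp
  have hggc : ∀ i, Continuous fun y : E => fderiv ℝ (fderiv ℝ f) (x + s • y) (b i) (b i) := fun i =>
    ((hffd.comp (by fun_prop)).clm_apply continuous_const).clm_apply continuous_const
  have hΨd : ∀ i (y : E), fderiv ℝ ballPotential y (b i) = -(ballWeight y * inner ℝ y (b i)) := by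
    intro i y
    rw [(hasFDerivAt_ballPotential y).fderiv]; simp
  have hi1 : ∀ i, Integrable fun y : E =>
      ballWeight y • (inner ℝ y (b i) • fderiv ℝ f (x + s • y) (b i)) := fun i =>
    integrable_ballWeight_smul ((by fun_prop : Continuous fun y : E => inner ℝ y (b i)).smul (hgc i))
  have hi2 : ∀ i, Integrable fun y : E =>
      ballPotential y • fderiv ℝ (fun y : E => fderiv ℝ f (x + s • y) (b i)) y (b i) := by
    intro i
    simp_rw [hgd]
    exact integrable_ballPotential_smul ((hggc i).const_smul s)
  have hibp : ∀ i, ∫ y : E, ballWeight y • (inner ℝ y (b i) • fderiv ℝ f (x + s • y) (b i)) =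
      s • ∫ y : E, ballPotential y • fderiv ℝ (fderiv ℝ f) (x + s • y) (b i) (b i) := by
    intro i
    have h := integral_smul_fderiv_eq_neg_fderiv_smul_of_integrable (μ := (volume : Measure E))
      (f := (ballPotential : E → ℝ))
      (g := fun y : E => fderiv ℝ f (x + s • y) (b i)) (v := b i)
      (by
        simp_rw [hΨd, neg_smul, mul_smul]
        exact (hi1 i).neg) (hi2 i) (integrable_ballPotential_smul (hgc i))
      (fun y _ => (hasFDerivAt_ballPotential y).differentiableAt)
      (fun y _ => (hg i y).differentiableAt)
    simp_rw [hgd, hΨd, neg_smul, mul_smul, integral_neg, neg_neg, smul_comm _ s] at h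
    rw [integral_smul] at h
    exact h.symm
  have hL : ∀ y : E, ballWeight y • fderiv ℝ f (x + s • y) y =
      ∑ i, ballWeight y • (inner ℝ y (b i) • fderiv ℝ f (x + s • y) (b i)) := by
    intro y
    rw [← Finset.smul_sum]
    congr 1
    set A := fderiv ℝ f (x + s • y)
    calc A y = A (∑ i, inner ℝ (b i) y • b i) := by rw [b.sum_repr']
      _ = _ := by simp_rw [map_sum, map_smul, real_inner_comm]
  have hR : ∀ y : E, ballPotential y • (Δ f) (x + s • y) =
      ∑ i, ballPotential y • fderiv ℝ (fderiv ℝ f) (x + s • y) (b i) (b i) := by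
    intro y
    rw [laplacian_eq_iteratedFDeriv_stdOrthonormalBasis, Finset.smul_sum]
    simp [iteratedFDeriv_two_apply, b]
  simp_rw [hL, hR]
  rw [integral_finsetSum _ fun i _ => hi1 i,
    integral_finsetSum _ fun i _ => integrable_ballPotential_smul (hggc i), Finset.smul_sum]
  exact Finset.sum_congr rfl fun i _ => hibp i

end derivative

end weights

/-! ### Rescaling to the unit ball, and localization. -/

section rescaling

variable {E F : Type*} [NormedAddCommGroup E] [NormedSpace ℝ E] [TopologicalSpace F] {f : E → F}
  {Ω : Set E} {x : E} {ε : ℝ}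

theorem add_smul_mem_closedBall {y : E} (hε : 0 ≤ ε) (hy : ‖y‖ ≤ 1) :
    x + ε • y ∈ Metric.closedBall x ε := by
  rw [mem_closedBall_iff_norm, add_sub_cancel_left, norm_smul, Real.norm_eq_abs, abs_of_nonneg hε]
  exact mul_le_of_le_one_right hε hy

theorem continuousOn_comp_add_smul (hf : ContinuousOn f Ω) (hε : 0 ≤ ε)
    (hx : Metric.closedBall x ε ⊆ Ω) :
    ContinuousOn (fun y => f (x + ε • y)) (Metric.closedBall 0 1) :=
  hf.comp (by fun_prop : Continuous fun y : E => x + ε • y).continuousOn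
    fun y hy => hx (add_smul_mem_closedBall hε (mem_closedBall_zero_iff.1 hy))

end rescaling

section localization

variable {E F : Type*} [NormedAddCommGroup E] [InnerProductSpace ℝ E] [FiniteDimensional ℝ E]
  [NormedAddCommGroup F] [NormedSpace ℝ F] {f : E → F} {Ω : Set E} {x : E} {ε : ℝ}

/-- Multiplication by a bump function that is 1 on the ball and supported in Ω; the derivative
formulas above need globally defined functions. -/
theorem exists_contDiff_eqOn_closedBall (hΩ : IsOpen Ω) (hε : 0 < ε)
    (hx : Metric.closedBall x ε ⊆ Ω) (hf : ∀ z ∈ Ω, ContDiffAt ℝ 2 f z) :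
    ∃ g : E → F, ContDiff ℝ 2 g ∧ EqOn g f (Metric.closedBall x ε) := by
  obtain ⟨δ, hδ, hδΩ⟩ := (isCompact_closedBall x ε).exists_cthickening_subset_open hΩ hx
  rw [cthickening_closedBall hδ.le hε.le] at hδΩ
  let χ : ContDiffBump x := ⟨ε, δ + ε, hε, by linarith⟩
  refine ⟨fun z => χ z • f z, ?_, fun z hz => ?_⟩
  · rw [← contMDiff_iff_contDiff]
    refine contMDiff_of_tsupport fun z hz =>
      contMDiffAt_iff_contDiffAt.2 (χ.contDiffAt.smul (hf z (hδΩ ?_)))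
    have h1 := tsupport_smul_subset_left (χ : E → ℝ) f hz
    rwa [χ.tsupport_eq] at h1
  · have : χ z = 1 := χ.one_of_mem_closedBall hz
    simp only [this, one_smul]

theorem continuous_laplacian (hf : ContDiff ℝ 2 f) : Continuous (Δ f) := by
  rw [laplacian_eq_iteratedFDeriv_stdOrthonormalBasis]
  refine continuous_finsetSum _ fun i _ => ?_
  exact (hf.continuous_iteratedFDeriv le_rfl).eval_const _

end localization

/-! ### The weighted mean value property characterizes harmonicity. -/

section meanvalue

variable {E : Type*} [NormedAddCommGroup E] [InnerProductSpace ℝ E] [FiniteDimensional ℝ E]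
  [MeasurableSpace E] [BorelSpace E]

variable (E) in
/-- The probability measure on the unit ball with density proportional to `ballWeight`. -/
noncomputable def ballMeasure : Measure E :=
  volume.withDensity fun y => ENNReal.ofReal ((∫ z : E, ballWeight z)⁻¹ * ballWeight y)

theorem measurable_ballMeasure_density :
    Measurable fun y : E => ENNReal.ofReal ((∫ z : E, ballWeight z)⁻¹ * ballWeight y) :=
  (contDiff_ballWeight.continuous.measurable.const_mul _).ennreal_ofReal

instance isProbabilityMeasure_ballMeasure : IsProbabilityMeasure (ballMeasure E) := by
  have h0 := integral_ballWeight_pos (E := E)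
  constructor
  rw [ballMeasure, withDensity_apply _ MeasurableSet.univ, setLIntegral_univ,
    ← ofReal_integral_eq_lintegral_ofReal, integral_const_mul, inv_mul_cancel₀ h0.ne',
    ENNReal.ofReal_one]
  · exact (contDiff_ballWeight.continuous.integrable_of_hasCompactSupport
      hasCompactSupport_ballWeight).const_mul _
  · exact .of_forall fun y => mul_nonneg (inv_nonneg.2 h0.le) (ballWeight_nonneg y)

theorem ae_ballMeasure_norm_lt : ∀ᵐ y ∂ballMeasure E, ‖y‖ < 1 := by
  rw [ballMeasure, ae_withDensity_iff measurable_ballMeasure_density]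
  refine .of_forall fun y hy => ?_
  by_contra h
  exact hy (by rw [ballWeight_eq_zero (not_lt.1 h)]; simp)

variable {F : Type*} [NormedAddCommGroup F]

theorem ContinuousOn.integrable_ballMeasure {f : E → F}
    (hf : ContinuousOn f (Metric.closedBall 0 1)) :
    Integrable f (ballMeasure E) := by
  have hr : (ballMeasure E).restrict (Metric.closedBall 0 1) = ballMeasure E :=
    Measure.restrict_eq_self_of_ae_mem
      (ae_ballMeasure_norm_lt.mono fun y hy => mem_closedBall_zero_iff.2 hy.le)
  rw [← hr]
  exact hf.integrableOn_compact (isCompact_closedBall 0 1)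

variable [NormedSpace ℝ F]

theorem integral_ballMeasure (g : E → F) :
    ∫ y, g y ∂ballMeasure E = (∫ z : E, ballWeight z)⁻¹ • ∫ y, ballWeight y • g y := by
  rw [ballMeasure, integral_withDensity_eq_integral_toReal_smul measurable_ballMeasure_density
    (.of_forall fun y => ENNReal.ofReal_lt_top), ← integral_smul]
  refine integral_congr_ae (.of_forall fun y => ?_)
  simp only
  rw [ENNReal.toReal_ofReal (mul_nonneg (inv_nonneg.2 integral_ballWeight_pos.le)
    (ballWeight_nonneg y)), mul_smul]

variable {f : E → F} {Ω : Set E} {x : E} {ε : ℝ}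

/-- The weighted mean value property of harmonic functions. -/
theorem InnerProductSpace.HarmonicOnNhd.eq_integral_ballMeasure (hΩ : IsOpen Ω) (hf : HarmonicOnNhd f Ω)
    (hε : 0 < ε) (hx : Metric.closedBall x ε ⊆ Ω) [CompleteSpace F] :
    f x = ∫ y, f (x + ε • y) ∂ballMeasure E := by
  obtain ⟨g, hg, hgf⟩ := exists_contDiff_eqOn_closedBall hΩ hε hx fun z hz => (hf z hz).1
  have hΔ : ∀ z ∈ Metric.ball x ε, (Δ g) z = 0 := by
    intro z hz
    have h1 : g =ᶠ[nhds z] f := Filter.eventuallyEq_of_mem (Metric.isOpen_ball.mem_nhds hz)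
      (hgf.mono Metric.ball_subset_closedBall)
    rw [(laplacian_congr_nhds h1).eq_of_nhds]
    exact (hf z (hx (Metric.ball_subset_closedBall hz))).2.eq_of_nhds
  -- The weighted mean over radius s has derivative s ∫ ψ Δg(x + s y) with ψ the potential. It
  -- vanishes since Δg = 0 in the open ball and ψ = 0 for ‖y‖ ≥ 1.
  have hder : ∀ s ∈ Icc 0 ε, HasDerivAt (fun s : ℝ => ∫ y, ballWeight y • g (x + s • y)) 0 s := by
    intro s hs
    have h := hasDerivAt_integral_ballWeight hg x s
    rw [integral_ballWeight_fderiv hg] at h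
    have h0 : ∫ y, ballPotential y • (Δ g) (x + s • y) = 0 := by
      refine integral_eq_zero_of_ae (.of_forall fun y => ?_)
      rcases lt_or_ge ‖y‖ 1 with hy | hy
      · simp only [Pi.zero_apply]
        rw [hΔ, smul_zero]
        rw [mem_ball_iff_norm, add_sub_cancel_left, norm_smul, Real.norm_eq_abs, abs_of_nonneg hs.1]
        nlinarith [hs.2, norm_nonneg y]
      · simp [ballPotential_eq_zero hy]
    rwa [h0, smul_zero] at h
  have hconst := constant_of_has_deriv_right_zero
    (fun s hs => (hder s hs).continuousAt.continuousWithinAt)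
    (fun s hs => (hder s ⟨hs.1, hs.2.le⟩).hasDerivWithinAt) ε ⟨hε.le, le_rfl⟩
  have hI := integral_ballWeight_pos (E := E)
  have h1 : ∫ y, f (x + ε • y) ∂ballMeasure E = ∫ y, g (x + ε • y) ∂ballMeasure E :=
    integral_congr_ae (ae_ballMeasure_norm_lt.mono fun y hy =>
      (hgf (add_smul_mem_closedBall hε.le hy.le)).symm)
  rw [h1, integral_ballMeasure, hconst]
  simp only [zero_smul, add_zero]
  rw [integral_smul_const, smul_smul, inv_mul_cancel₀ hI.ne', one_smul,
    hgf (Metric.mem_closedBall_self hε.le)]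

/-- At a fixed radius the mean value identity exhibits f near x as a constant times a convolution
with a smooth compactly supported kernel. -/
theorem contDiffAt_of_eq_integral_ballMeasure [CompleteSpace F] (hΩ : IsOpen Ω)
    (hf : ContinuousOn f Ω)
    (hmv : ∀ x ε, 0 < ε → Metric.closedBall x ε ⊆ Ω → f x = ∫ y, f (x + ε • y) ∂ballMeasure E)
    (hx : x ∈ Ω) : ContDiffAt ℝ 2 f x := by
  obtain ⟨r, hr, hrΩ⟩ := Metric.nhds_basis_closedBall.mem_iff.1 (hΩ.mem_nhds hx)
  -- Half the radius: balls of radius ε centred within ε of x stay where the truncation `f₁` agrees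
  -- with f.
  set ε := r / 2 with hε
  have hε0 : 0 < ε := by positivity
  set f₁ : E → F := (Metric.closedBall x r).indicator f with hf₁
  set κ : E → ℝ := fun z => ballWeight (ε⁻¹ • z) with hκ
  have hf₁i : LocallyIntegrable f₁ :=
    ((integrable_indicator_iff measurableSet_closedBall).2
      ((hf.mono hrΩ).integrableOn_compact (isCompact_closedBall x r))).locallyIntegrable
  have hκs : HasCompactSupport κ :=
    hasCompactSupport_ballWeight.comp_smul (inv_ne_zero hε0.ne')
  have hκd : ContDiff ℝ 2 κ :=
    (contDiff_infty.1 contDiff_ballWeight 2).comp (contDiff_const_smul _)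
  have hconv := hκs.contDiff_convolution_left (ContinuousLinearMap.lsmul ℝ ℝ) hκd hf₁i
  have heq : ∀ z ∈ Metric.ball x ε, f z = (∫ z : E, ballWeight z)⁻¹ •
      |((-ε) ^ Module.finrank ℝ E)⁻¹| •
      (convolution κ f₁ (ContinuousLinearMap.lsmul ℝ ℝ) volume) z := by
    intro z hz
    have hzΩ : Metric.closedBall z ε ⊆ Metric.closedBall x r := by
      refine Metric.closedBall_subset_closedBall' ?_
      rw [Metric.mem_ball] at hz
      linarith
    rw [hmv z ε hε0 (hzΩ.trans hrΩ), integral_ballMeasure]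
    congr 1
    -- Substitution t = -ε y; the sign is harmless because the weight is even.
    rw [convolution_def, ← Measure.integral_comp_smul]
    refine integral_congr_ae (.of_forall fun y => ?_)
    simp only [ContinuousLinearMap.lsmul_apply, hκ, neg_smul, smul_neg, sub_neg_eq_add,
      ballWeight_neg]
    rw [smul_smul, inv_mul_cancel₀ hε0.ne', one_smul]
    rcases lt_or_ge ‖y‖ 1 with hy | hy
    · rw [hf₁, indicator_of_mem (hzΩ (add_smul_mem_closedBall hε0.le hy.le))]
    · simp [ballWeight_eq_zero hy]
  exact (((hconv.const_smul _).const_smul _).contDiffAt).congr_of_eventuallyEq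
    (Filter.eventuallyEq_of_mem (Metric.ball_mem_nhds x hε0) heq)

/-- A continuous function with the weighted mean value property is harmonic. -/
theorem harmonicOnNhd_of_eq_integral_ballMeasure [CompleteSpace F] (hΩ : IsOpen Ω)
    (hf : ContinuousOn f Ω)
    (hmv : ∀ x ε, 0 < ε → Metric.closedBall x ε ⊆ Ω → f x = ∫ y, f (x + ε • y) ∂ballMeasure E) :
    HarmonicOnNhd f Ω := by
  have hC : ∀ z ∈ Ω, ContDiffAt ℝ 2 f z := fun z hz =>
    contDiffAt_of_eq_integral_ballMeasure hΩ hf hmv hz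
  have hΔ : ∀ x ∈ Ω, (Δ f) x = 0 := by
    intro x hx
    obtain ⟨ε, hε, hεΩ⟩ := Metric.nhds_basis_closedBall.mem_iff.1 (hΩ.mem_nhds hx)
    obtain ⟨g, hg, hgf⟩ := exists_contDiff_eqOn_closedBall hΩ hε hεΩ hC
    have hI := integral_ballWeight_pos (E := E)
    have hconst : ∀ s ∈ Ioo 0 ε, ∫ y, ballWeight y • g (x + s • y) =
        (∫ z : E, ballWeight z) • f x := by
      intro s hs
      have hsub : Metric.closedBall x s ⊆ Metric.closedBall x ε :=
        Metric.closedBall_subset_closedBall hs.2.le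
      rw [hmv x s hs.1 (hsub.trans hεΩ), integral_ballMeasure, smul_smul, mul_inv_cancel₀ hI.ne',
        one_smul]
      refine integral_congr_ae (.of_forall fun y => ?_)
      rcases lt_or_ge ‖y‖ 1 with hy | hy
      · simp only [hgf (hsub (add_smul_mem_closedBall hs.1.le hy.le))]
      · simp [ballWeight_eq_zero hy]
    have hJ : ∀ s ∈ Ioo 0 ε, ∫ y, ballPotential y • (Δ g) (x + s • y) = 0 := by
      intro s hs
      have h := hasDerivAt_integral_ballWeight hg x s
      rw [integral_ballWeight_fderiv hg] at h
      have h2 : HasDerivAt (fun s : ℝ => ∫ y, ballWeight y • g (x + s • y)) 0 s :=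
        (hasDerivAt_const s ((∫ z : E, ballWeight z) • f x)).congr_of_eventuallyEq
          (Filter.eventuallyEq_of_mem (Ioo_mem_nhds hs.1 hs.2) hconst)
      exact (smul_eq_zero.1 (h.unique h2)).resolve_left hs.1.ne'
    have hJc : Continuous fun s : ℝ => ∫ y, ballPotential y • (Δ g) (x + s • y) := by
      have hset : ∀ s : ℝ, ∫ y in Metric.closedBall (0 : E) 1,
          ballPotential y • (Δ g) (x + s • y) = ∫ y, ballPotential y • (Δ g) (x + s • y) := by
        intro s
        refine setIntegral_eq_integral_of_forall_compl_eq_zero fun y hy => ?_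
        rw [mem_closedBall_zero_iff, not_le] at hy
        rw [ballPotential_eq_zero hy.le, zero_smul]
      simp_rw [← hset]
      refine continuous_parametric_integral_of_continuous ?_ (isCompact_closedBall (0 : E) 1)
      exact (continuous_ballPotential.comp continuous_snd).smul
        ((continuous_laplacian hg).comp (by fun_prop))
    -- The derivative identity carries a factor s, so it says nothing at s = 0; the value there
    -- comes by continuity and equals (∫ ψ) Δg(x).
    have hJ0 : ∫ y, ballPotential y • (Δ g) (x + (0 : ℝ) • y) = 0 := by
      have h1 : Filter.Tendsto (fun s : ℝ => ∫ y, ballPotential y • (Δ g) (x + s • y))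
          (nhdsWithin 0 (Ioi 0)) (nhds (∫ y, ballPotential y • (Δ g) (x + (0 : ℝ) • y))) :=
        (hJc.tendsto 0).mono_left nhdsWithin_le_nhds
      refine tendsto_nhds_unique h1 (tendsto_const_nhds.congr' ?_)
      filter_upwards [Ioo_mem_nhdsGT hε] with s hs
      exact (hJ s hs).symm
    simp only [zero_smul, add_zero] at hJ0
    rw [integral_smul_const, smul_eq_zero] at hJ0
    have h1 : g =ᶠ[nhds x] f := Filter.eventuallyEq_of_mem (Metric.ball_mem_nhds x hε)
      (hgf.mono Metric.ball_subset_closedBall)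
    rw [← (laplacian_congr_nhds h1).eq_of_nhds]
    exact hJ0.resolve_left integral_ballPotential_pos.ne'
  exact fun x hx => ⟨hC x hx, Filter.eventually_of_mem (hΩ.mem_nhds hx) hΔ⟩

end meanvalue

/-! ### Polar coordinates: from sphere means to ball means. -/

section polar

variable {E : Type*} [NormedAddCommGroup E] [NormedSpace ℝ E] [FiniteDimensional ℝ E]
  [MeasurableSpace E] [BorelSpace E] {μ : Measure E} [μ.IsAddHaarMeasure]

theorem integrable_polar {H : E → ℝ} (hH : Integrable H μ) :
    Integrable (fun p : Metric.sphere (0 : E) 1 × Ioi (0 : ℝ) => H ((p.2 : ℝ) • (p.1 : E)))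
      (μ.toSphere.prod (Measure.volumeIoiPow (Module.finrank ℝ E - 1))) := by
  have hmp := μ.measurePreserving_homeomorphUnitSphereProd
  rw [← hmp.integrable_comp_emb (Homeomorph.measurableEmbedding _)]
  have h1 : ((fun p : Metric.sphere (0 : E) 1 × Ioi (0 : ℝ) => H ((p.2 : ℝ) • (p.1 : E))) ∘
      homeomorphUnitSphereProd E) = fun z : ({0}ᶜ : Set E) => H z := by
    ext z
    have hz : ‖(z : E)‖ ≠ 0 := norm_ne_zero_iff.2 z.2
    simp [smul_smul, hz]
  rw [h1]
  have hemb := MeasurableEmbedding.subtype_coe (measurableSet_singleton (0 : E)).compl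
  rw [← Function.comp_def H, ← hemb.integrable_map_iff, hemb.map_comap, Subtype.range_coe]
  exact hH.restrict

theorem integral_polar [Nontrivial E] {H : E → ℝ} (hH : Integrable H μ) :
    ∫ y, H y ∂μ = ∫ r : Ioi (0 : ℝ), ∫ u : Metric.sphere (0 : E) 1, H ((r : ℝ) • (u : E)) ∂μ.toSphere
      ∂(Measure.volumeIoiPow (Module.finrank ℝ E - 1)) := by
  have hmp := μ.measurePreserving_homeomorphUnitSphereProd
  rw [← integral_prod_symm _ (integrable_polar hH),
    ← hmp.integral_comp (Homeomorph.measurableEmbedding _)]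
  have h1 : ∀ z : ({0}ᶜ : Set E), H ((((homeomorphUnitSphereProd E) z).2 : ℝ) •
      (((homeomorphUnitSphereProd E) z).1 : E)) = H z := by
    intro z
    have hz : ‖(z : E)‖ ≠ 0 := norm_ne_zero_iff.2 z.2
    simp [smul_smul, hz]
  simp_rw [h1]
  rw [integral_subtype_comap (measurableSet_singleton (0 : E)).compl,
    restrict_compl_singleton]

theorem integral_le_integral_of_sphere_le [Nontrivial E] {H₁ H₂ : E → ℝ} (h₁ : Integrable H₁ μ)
    (h₂ : Integrable H₂ μ)
    (h : ∀ r : ℝ, 0 < r → ∫ u : Metric.sphere (0 : E) 1, H₁ (r • (u : E)) ∂μ.toSphere ≤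
      ∫ u : Metric.sphere (0 : E) 1, H₂ (r • (u : E)) ∂μ.toSphere) :
    ∫ y, H₁ y ∂μ ≤ ∫ y, H₂ y ∂μ := by
  rw [integral_polar h₁, integral_polar h₂]
  exact integral_mono (integrable_polar h₁).integral_prod_right
    (integrable_polar h₂).integral_prod_right fun r => h r r.2

end polar

section sphere

variable {m : ℕ}

theorem nontrivial_euclideanSpace (hm : 1 ≤ m) : Nontrivial (EuclideanSpace ℝ (Fin m)) :=
  Module.nontrivial_of_finrank_pos (R := ℝ) (by rw [finrank_euclideanSpace_fin]; omega)

theorem toSphere_univ_ne_zero (hm : 1 ≤ m) :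
    (volume : Measure (EuclideanSpace ℝ (Fin m))).toSphere univ ≠ 0 := by
  have := nontrivial_euclideanSpace hm
  rw [Ne, Measure.measure_univ_eq_zero]
  exact Measure.toSphere_ne_zero _

theorem isFiniteMeasure_normalizedSphereMeasure (hm : 1 ≤ m) (x : EuclideanSpace ℝ (Fin m))
    (r : ℝ) : IsFiniteMeasure (normalizedSphereMeasure x r) := by
  rw [normalizedSphereMeasure]
  have : IsFiniteMeasure (((volume : Measure (EuclideanSpace ℝ (Fin m))).toSphere univ)⁻¹ •
      (volume : Measure (EuclideanSpace ℝ (Fin m))).toSphere) :=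
    Measure.smul_finite _ (ENNReal.inv_ne_top.2 (toSphere_univ_ne_zero hm))
  infer_instance

theorem setIntegral_normalizedSphereMeasure (x : EuclideanSpace ℝ (Fin m)) {r : ℝ} (hr : 0 < r)
    (g : EuclideanSpace ℝ (Fin m) → ℝ) :
    ∫ y in Metric.sphere x r, g y ∂normalizedSphereMeasure x r =
      ((volume : Measure (EuclideanSpace ℝ (Fin m))).toSphere.real univ)⁻¹ *
        ∫ u : Metric.sphere (0 : EuclideanSpace ℝ (Fin m)) 1,
          g (x + r • (u : EuclideanSpace ℝ (Fin m)))
          ∂(volume : Measure (EuclideanSpace ℝ (Fin m))).toSphere := by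
  have hemb : MeasurableEmbedding fun u : Metric.sphere (0 : EuclideanSpace ℝ (Fin m)) 1 =>
      x + r • (u : EuclideanSpace ℝ (Fin m)) := by
    refine Topology.IsClosedEmbedding.measurableEmbedding
      ((by fun_prop : Continuous fun u : Metric.sphere (0 : EuclideanSpace ℝ (Fin m)) 1 =>
        x + r • (u : EuclideanSpace ℝ (Fin m))).isClosedEmbedding fun u v huv => ?_)
    simpa [hr.ne', Subtype.ext_iff] using huv
  rw [normalizedSphereMeasure, hemb.setIntegral_map]
  have hpre : (fun u : Metric.sphere (0 : EuclideanSpace ℝ (Fin m)) 1 =>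
      x + r • (u : EuclideanSpace ℝ (Fin m))) ⁻¹' Metric.sphere x r = univ := by
    ext u
    simp [norm_smul, abs_of_pos hr]
  rw [hpre, setIntegral_univ, integral_smul_measure, smul_eq_mul, ENNReal.toReal_inv]
  rfl

/-- The sub-mean value property over spheres implies the weighted one over balls. -/
theorem integral_ballMeasure_le_of_sphere_le (hm : 1 ≤ m) {x : EuclideanSpace ℝ (Fin m)} {ε : ℝ}
    (hε : 0 < ε) {g : EuclideanSpace ℝ (Fin m) → ℝ} (hg : ContinuousOn g (Metric.closedBall x ε))
    (h : ∀ r, 0 < r → r ≤ ε →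
      ∫ y in Metric.sphere x r, g y ∂normalizedSphereMeasure x r ≤ g x) :
    ∫ y, g (x + ε • y) ∂ballMeasure (EuclideanSpace ℝ (Fin m)) ≤ g x := by
  have := nontrivial_euclideanSpace hm
  have hI := integral_ballWeight_pos (E := EuclideanSpace ℝ (Fin m))
  have hσ : 0 < (volume : Measure (EuclideanSpace ℝ (Fin m))).toSphere.real univ :=
    ENNReal.toReal_pos (toSphere_univ_ne_zero hm) (measure_ne_top _ _)
  rw [integral_ballMeasure, smul_eq_mul, inv_mul_le_iff₀ hI, ← integral_mul_const]
  have hi2 : Integrable fun y : EuclideanSpace ℝ (Fin m) => ballWeight y * g x :=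
    integrable_ballWeight_smul continuous_const
  have hi1 : Integrable fun y : EuclideanSpace ℝ (Fin m) => ballWeight y * g (x + ε • y) := by
    have hc : ContinuousOn (fun y : EuclideanSpace ℝ (Fin m) => ballWeight y * g (x + ε • y))
        (Metric.closedBall 0 1) :=
      contDiff_ballWeight.continuous.continuousOn.mul
        (continuousOn_comp_add_smul hg hε.le Subset.rfl)
    refine (integrableOn_iff_integrable_of_support_subset ?_).1
      (hc.integrableOn_compact (isCompact_closedBall 0 1))
    intro y hy
    by_contra hy1
    rw [mem_closedBall_zero_iff, not_le] at hy1
    exact hy (by simp [ballWeight_eq_zero hy1.le])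
  refine integral_le_integral_of_sphere_le hi1 hi2 fun r hr => ?_
  have hw : ∀ u : Metric.sphere (0 : EuclideanSpace ℝ (Fin m)) 1,
      ballWeight (r • (u : EuclideanSpace ℝ (Fin m))) = radialCutoff (r ^ 2) := by
    intro u
    simp [ballWeight, norm_smul, abs_of_pos hr]
  simp_rw [smul_eq_mul, hw, integral_const_mul, smul_smul]
  -- The shell of radius r < 1 corresponds to the sphere of radius ε r about x; from radius one on
  -- the weight is zero.
  rcases lt_or_ge r 1 with hr1 | hr1
  · refine mul_le_mul_of_nonneg_left ?_ (radialCutoff_nonneg _)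
    have h1 := h (ε * r) (by positivity) (by nlinarith)
    rw [setIntegral_normalizedSphereMeasure x (by positivity), inv_mul_le_iff₀ hσ] at h1
    simpa using h1
  · rw [radialCutoff_eq_zero (one_le_pow₀ hr1), zero_mul, zero_mul]

end sphere

/-! ### Subharmonic families through their support functions. -/

section family

variable {m n : ℕ} {Ω : Set (EuclideanSpace ℝ (Fin m))}
  {A : EuclideanSpace ℝ (Fin m) → ConvexBody (EuclideanSpace ℝ (Fin n))}

theorem IsSubharmonicFamily.continuousOn_supportFn (hA : IsSubharmonicFamily Ω A)
    (ξ : EuclideanSpace ℝ (Fin n)) :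
    ContinuousOn (fun y => supportFn (A y : Set (EuclideanSpace ℝ (Fin n))) ξ) Ω :=
  (continuous_supportFn_body ξ).comp_continuousOn hA.continuousOn

/-- The averaged support function is sublinear, so the Minkowski integral contains a point attaining
it in direction ξ. That point lies in A_x. -/
theorem IsSubharmonicFamily.sphere_le (hm : 1 ≤ m) (hA : IsSubharmonicFamily Ω A)
    {x : EuclideanSpace ℝ (Fin m)} {r : ℝ} (hr : 0 < r) (hx : Metric.closedBall x r ⊆ Ω)
    (ξ : EuclideanSpace ℝ (Fin n)) :
    ∫ y in Metric.sphere x r, supportFn (A y : Set (EuclideanSpace ℝ (Fin n))) ξ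
      ∂normalizedSphereMeasure x r ≤ supportFn (A x : Set (EuclideanSpace ℝ (Fin n))) ξ := by
  have := isFiniteMeasure_normalizedSphereMeasure hm x r
  have hint : ∀ ξ, IntegrableOn (fun y => supportFn (A y : Set (EuclideanSpace ℝ (Fin n))) ξ)
      (Metric.sphere x r) (normalizedSphereMeasure x r) := fun ξ =>
    ((hA.continuousOn_supportFn ξ).mono (Metric.sphere_subset_closedBall.trans hx)).integrableOn_compact
      (isCompact_sphere x r)
  obtain ⟨ζ, hζ, h⟩ := exists_mem_setOfSupportFn_inner_eq
    (h := fun ξ => ∫ y in Metric.sphere x r, supportFn (A y : Set (EuclideanSpace ℝ (Fin n))) ξ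
      ∂normalizedSphereMeasure x r)
    (fun ξ η => by
      rw [← integral_add (hint ξ) (hint η)]
      exact integral_mono (hint _) ((hint ξ).add (hint η))
        fun y => supportFn_add_right_le (A y).isCompact (A y).nonempty ξ η)
    (fun c hc ξ => by
      rw [← integral_const_mul]
      simp_rw [supportFn_smul_right hc.le]) ξ
  rw [← h]
  exact inner_le_supportFn (A x).isCompact (hA.integral_subset x r hr hx hζ) ξ

theorem IsSubharmonicFamily.integral_supportFn_le (hm : 1 ≤ m) (hA : IsSubharmonicFamily Ω A)
    {x : EuclideanSpace ℝ (Fin m)} {ε : ℝ} (hε : 0 < ε) (hx : Metric.closedBall x ε ⊆ Ω)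
    (ξ : EuclideanSpace ℝ (Fin n)) :
    ∫ y, supportFn (A (x + ε • y) : Set (EuclideanSpace ℝ (Fin n))) ξ
      ∂ballMeasure (EuclideanSpace ℝ (Fin m)) ≤
        supportFn (A x : Set (EuclideanSpace ℝ (Fin n))) ξ :=
  integral_ballMeasure_le_of_sphere_le hm hε ((hA.continuousOn_supportFn ξ).mono hx)
    fun _ hr hrε => hA.sphere_le hm hr ((Metric.closedBall_subset_closedBall hrε).trans hx) ξ

end family

/-! ### Vanishing of nonnegative functions and the minimum principle. -/

section ballMeasure

variable {E : Type*} [NormedAddCommGroup E] [InnerProductSpace ℝ E] [FiniteDimensional ℝ E]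
  [MeasurableSpace E] [BorelSpace E]

theorem integral_ballMeasure_comp_neg {F : Type*} [NormedAddCommGroup F] [NormedSpace ℝ F]
    (g : E → F) : ∫ y, g (-y) ∂ballMeasure E = ∫ y, g y ∂ballMeasure E := by
  rw [integral_ballMeasure, integral_ballMeasure,
    ← integral_neg_eq_self (fun y : E => ballWeight y • g y)]
  simp_rw [ballWeight_neg]

/-- The density is positive on the open unit ball, so u vanishes there Lebesgue-almost everywhere,
hence everywhere by continuity. -/
theorem eq_zero_of_integral_ballMeasure_nonpos {u : E → ℝ}
    (hu : ContinuousOn u (Metric.closedBall 0 1)) (h0 : ∀ y ∈ Metric.closedBall 0 1, 0 ≤ u y)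
    (hi : ∫ y, u y ∂ballMeasure E ≤ 0) {y : E} (hy : ‖y‖ < 1) : u y = 0 := by
  have hnn : 0 ≤ᵐ[ballMeasure E] u :=
    ae_ballMeasure_norm_lt.mono fun y hy => h0 y (mem_closedBall_zero_iff.2 hy.le)
  have hae : u =ᵐ[ballMeasure E] 0 :=
    (integral_eq_zero_iff_of_nonneg_ae hnn hu.integrable_ballMeasure).1
      (le_antisymm hi (integral_nonneg_of_ae hnn))
  have hI := integral_ballWeight_pos (E := E)
  have hae' : u =ᵐ[volume.restrict (Metric.ball (0 : E) 1)] fun _ => 0 := by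
    rw [Filter.EventuallyEq, ae_restrict_iff' measurableSet_ball]
    rw [Filter.EventuallyEq, ballMeasure, ae_withDensity_iff measurable_ballMeasure_density] at hae
    filter_upwards [hae] with z hz hzb
    refine hz ?_
    rw [Ne, ENNReal.ofReal_eq_zero, not_le]
    exact mul_pos (inv_pos.2 hI) (ballWeight_pos (mem_ball_zero_iff.1 hzb))
  exact Measure.eqOn_open_of_ae_eq hae' Metric.isOpen_ball (hu.mono Metric.ball_subset_closedBall)
    continuousOn_const (mem_ball_zero_iff.2 hy)

/-- The strong minimum principle for nonnegative harmonic functions. -/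
theorem InnerProductSpace.HarmonicOnNhd.pos_of_nonneg {Ω : Set E} {f : E → ℝ} (hΩ : IsOpen Ω)
    (hΩc : IsPreconnected Ω) (hf : HarmonicOnNhd f Ω) (h0 : ∀ x, 0 ≤ f x)
    (hpos : ∃ x ∈ Ω, 0 < f x) : ∀ x ∈ Ω, 0 < f x := by
  obtain ⟨x₀, hx₀, hfx₀⟩ := hpos
  intro x hx
  -- Positivity is locally constant: near a zero the mean value property makes f vanish, near a
  -- positive value continuity keeps it positive.
  refine (hΩc.induction₂ (fun x y => 0 < f x ↔ 0 < f y) (fun x hx => ?_)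
    (fun _ _ _ _ _ _ h₁ h₂ => h₁.trans h₂) (fun _ _ _ _ h => h.symm) hx₀ hx).1 hfx₀
  refine Filter.Eventually.filter_mono nhdsWithin_le_nhds ?_
  have hcx := hf.continuousOn.continuousAt (hΩ.mem_nhds hx)
  rcases (h0 x).eq_or_lt' with h | h
  · obtain ⟨ε, hε, hεΩ⟩ := Metric.nhds_basis_closedBall.mem_iff.1 (hΩ.mem_nhds hx)
    filter_upwards [Metric.ball_mem_nhds x hε] with z hz
    have hz0 := eq_zero_of_integral_ballMeasure_nonpos
      (continuousOn_comp_add_smul hf.continuousOn hε.le hεΩ) (fun y _ => h0 _)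
      (by rw [← hf.eq_integral_ballMeasure hΩ hε hεΩ, h]) (y := ε⁻¹ • (z - x))
      (by
        rw [mem_ball_iff_norm] at hz
        rw [norm_smul, norm_inv, Real.norm_eq_abs, abs_of_pos hε, inv_mul_lt_iff₀ hε, mul_one]
        exact hz)
    simp only [smul_smul, mul_inv_cancel₀ hε.ne', one_smul, add_sub_cancel] at hz0
    rw [h, hz0]
  · filter_upwards [hcx.eventually (lt_mem_nhds h)] with z hz
    exact ⟨fun _ => hz, fun _ => h⟩

end ballMeasure

/-! ### Rigidity of families with harmonic volume root. -/

section bodies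

variable {m n : ℕ}

theorem continuous_add_body : Continuous
    fun p : ConvexBody (EuclideanSpace ℝ (Fin n)) × ConvexBody (EuclideanSpace ℝ (Fin n)) =>
      p.1 + p.2 := by
  refine (LipschitzWith.of_dist_le_mul (K := 2) fun p q => ?_).continuous
  refine dist_le_of_abs_supportFn_sub_le (by positivity) fun ξ => ?_
  rw [ConvexBody.supportFn_add, ConvexBody.supportFn_add]
  have h1 := abs_supportFn_sub_le p.1 q.1 ξ
  have h2 := abs_supportFn_sub_le p.2 q.2 ξ
  have h3 : dist p.1 q.1 * ‖ξ‖ ≤ dist p q * ‖ξ‖ := by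
    gcongr; exact le_max_left _ _
  have h4 : dist p.2 q.2 * ‖ξ‖ ≤ dist p q * ‖ξ‖ := by
    gcongr; exact le_max_right _ _
  rw [add_sub_add_comm]
  refine (abs_add_le _ _).trans ?_
  push_cast
  linarith

variable {Ω : Set (EuclideanSpace ℝ (Fin m))}
  {A : EuclideanSpace ℝ (Fin m) → ConvexBody (EuclideanSpace ℝ (Fin n))}

/-- Antipodal bodies attain equality in Brunn–Minkowski: the deficit is nonnegative and continuous,
and its mean is at most 2 V(A_x) - 2 V(A_x) = 0. -/
theorem IsSubharmonicFamily.volumeRoot_add_le (hm : 1 ≤ m) (hn : 1 ≤ n) (hΩ : IsOpen Ω)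
    (hA : IsSubharmonicFamily Ω A) (hf : HarmonicOnNhd (fun x => volumeRoot (A x)) Ω)
    {x y : EuclideanSpace ℝ (Fin m)} {ε : ℝ} (hε : 0 < ε) (hx : Metric.closedBall x ε ⊆ Ω)
    (hy : ‖y‖ < 1) :
    volumeRoot (A (x + ε • -y) + A (x + ε • y)) ≤
      volumeRoot (A (x + ε • -y)) + volumeRoot (A (x + ε • y)) := by
  have hA₁ : ContinuousOn (fun y => A (x + ε • y)) (Metric.closedBall 0 1) :=
    continuousOn_comp_add_smul hA.continuousOn hε.le hx
  have hA₂ : ContinuousOn (fun y => A (x + ε • -y)) (Metric.closedBall 0 1) :=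
    hA₁.comp continuous_neg.continuousOn fun y hy => by simpa using hy
  have hK : ContinuousOn (fun y => A (x + ε • -y) + A (x + ε • y)) (Metric.closedBall 0 1) :=
    continuous_add_body.comp_continuousOn (hA₂.prodMk hA₁)
  have hV := continuous_volumeRoot (n := n) hn
  have hV₁ : ContinuousOn (fun y => volumeRoot (A (x + ε • y))) (Metric.closedBall 0 1) :=
    hV.comp_continuousOn hA₁
  have hV₂ : ContinuousOn (fun y => volumeRoot (A (x + ε • -y))) (Metric.closedBall 0 1) :=
    hV.comp_continuousOn hA₂
  have hVK : ContinuousOn (fun y => volumeRoot (A (x + ε • -y) + A (x + ε • y)))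
      (Metric.closedBall 0 1) := hV.comp_continuousOn hK
  have hsup : ∀ ξ, ∫ y, supportFn
      (↑(A (x + ε • -y) + A (x + ε • y)) : Set (EuclideanSpace ℝ (Fin n))) ξ
      ∂ballMeasure (EuclideanSpace ℝ (Fin m)) ≤
        supportFn (↑((2 : ℝ) • A x) : Set (EuclideanSpace ℝ (Fin n))) ξ := by
    intro ξ
    have hc := continuous_supportFn_body ξ
    have h₁ : ContinuousOn (fun y => supportFn (A (x + ε • y) : Set (EuclideanSpace ℝ (Fin n))) ξ)
        (Metric.closedBall 0 1) := hc.comp_continuousOn hA₁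
    have h₂ : ContinuousOn (fun y => supportFn (A (x + ε • -y) : Set (EuclideanSpace ℝ (Fin n))) ξ)
        (Metric.closedBall 0 1) := hc.comp_continuousOn hA₂
    simp_rw [ConvexBody.supportFn_add]
    rw [ConvexBody.supportFn_smul zero_le_two,
      integral_add h₂.integrable_ballMeasure h₁.integrable_ballMeasure, integral_ballMeasure_comp_neg
      (fun y => supportFn (A (x + ε • y) : Set (EuclideanSpace ℝ (Fin n))) ξ)]
    have := hA.integral_supportFn_le hm hε hx ξ
    linarith
  have hBM := integral_volumeRoot_le hn (isCompact_closedBall 0 1)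
    (ae_ballMeasure_norm_lt.mono fun y hy => mem_closedBall_zero_iff.2 hy.le) hK hsup
  rw [volumeRoot_smul hn zero_le_two] at hBM
  have hfx : volumeRoot (A x) = ∫ y, volumeRoot (A (x + ε • y)) ∂ballMeasure _ :=
    hf.eq_integral_ballMeasure hΩ hε hx
  have hfx' : volumeRoot (A x) = ∫ y, volumeRoot (A (x + ε • -y)) ∂ballMeasure _ :=
    hfx.trans (integral_ballMeasure_comp_neg (fun y => volumeRoot (A (x + ε • y)))).symm
  have hu := eq_zero_of_integral_ballMeasure_nonpos
    (u := fun y => volumeRoot (A (x + ε • -y) + A (x + ε • y)) -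
      (volumeRoot (A (x + ε • -y)) + volumeRoot (A (x + ε • y))))
    (hVK.sub (hV₂.add hV₁))
    (fun y _ => sub_nonneg.2 (_root_.volumeRoot_add_le hn _ _))
    (by
      have hVs : ContinuousOn (fun y => volumeRoot (A (x + ε • -y)) + volumeRoot (A (x + ε • y)))
          (Metric.closedBall 0 1) := hV₂.add hV₁
      rw [integral_sub hVK.integrable_ballMeasure hVs.integrable_ballMeasure,
        integral_add hV₂.integrable_ballMeasure hV₁.integrable_ballMeasure]
      linarith) hy
  exact (sub_eq_zero.1 hu).le

/-- If the root of the volume is harmonic and positive, then the bodies of a subharmonic family are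
homothetic to each other. -/
theorem IsSubharmonicFamily.exists_homothety (hm : 1 ≤ m) (hn : 1 ≤ n) (hΩ : IsOpen Ω)
    (hΩc : IsPreconnected Ω) (hA : IsSubharmonicFamily Ω A)
    (hf : HarmonicOnNhd (fun x => volumeRoot (A x)) Ω) (hpos : ∀ x ∈ Ω, 0 < volumeRoot (A x))
    {x₀ x : EuclideanSpace ℝ (Fin m)} (hx₀ : x₀ ∈ Ω) (hx : x ∈ Ω) :
    ∃ v, (volumeRoot (A x))⁻¹ • (A x : Set (EuclideanSpace ℝ (Fin n))) =
      (volumeRoot (A x₀))⁻¹ • (A x₀ : Set (EuclideanSpace ℝ (Fin n))) + {v} := by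
  refine hΩc.induction₂ (fun x₀ x => ∃ v,
    (volumeRoot (A x))⁻¹ • (A x : Set (EuclideanSpace ℝ (Fin n))) =
      (volumeRoot (A x₀))⁻¹ • (A x₀ : Set (EuclideanSpace ℝ (Fin n))) + {v})
    (fun x hx => ?_) ?_ ?_ hx₀ hx
  · refine Filter.Eventually.filter_mono nhdsWithin_le_nhds ?_
    obtain ⟨r, hr, hrΩ⟩ := Metric.nhds_basis_closedBall.mem_iff.1 (hΩ.mem_nhds hx)
    filter_upwards [Metric.ball_mem_nhds x hr] with z hz
    have hzx : ‖z - x‖ < r := mem_ball_iff_norm.1 hz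
    -- The midpoint of x and z. With radius r/2 and y = (z - x)/r the antipodal pair about c is
    -- exactly x and z, and the ball about c lies in the one about x.
    set c := x + (2 : ℝ)⁻¹ • (z - x) with hc
    set y := r⁻¹ • (z - x) with hy
    have hy1 : ‖y‖ < 1 := by
      rw [hy, norm_smul, norm_inv, Real.norm_eq_abs, abs_of_pos hr, inv_mul_lt_iff₀ hr, mul_one]
      exact hzx
    have hcball : Metric.closedBall c (r / 2) ⊆ Ω := by
      refine (Metric.closedBall_subset_closedBall' ?_).trans hrΩ
      rw [hc, dist_self_add_left, norm_smul]
      norm_num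
      linarith
    have hry : (r / 2) • y = (2 : ℝ)⁻¹ • (z - x) := by
      rw [hy, smul_smul]; congr 1; field_simp
    have h1 : c + (r / 2) • -y = x := by rw [smul_neg, hry, hc]; abel
    have h2 : c + (r / 2) • y = z := by
      rw [hry, hc, add_assoc, ← add_smul]; norm_num
    have hV := hA.volumeRoot_add_le hm hn hΩ hf (by positivity) hcball hy1
    rw [h1, h2] at hV
    have hzp := hpos z (hrΩ (Metric.ball_subset_closedBall hz))
    obtain ⟨v, hv⟩ := eq_smul_add_of_volumeRoot_add_eq hn (hpos x hx) hzp hV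
    refine ⟨(volumeRoot (A z))⁻¹ • v, ?_⟩
    rw [hv, smul_add, smul_smul, smul_set_singleton, div_eq_mul_inv, ← mul_assoc,
      inv_mul_cancel₀ hzp.ne', one_mul]
  · rintro a b c - - - ⟨v, hv⟩ ⟨w, hw⟩
    exact ⟨v + w, by rw [hw, hv, add_assoc, singleton_add_singleton]⟩
  · rintro a b - - ⟨v, hv⟩
    exact ⟨-v, by rw [hv, add_assoc, singleton_add_singleton, add_neg_cancel, singleton_zero,
      add_zero]⟩

/-- The translation part of a subharmonic family of homothetic bodies with harmonic dilation factor
is harmonic. -/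
theorem IsSubharmonicFamily.harmonicOnNhd_translation (hm : 1 ≤ m) (hΩ : IsOpen Ω)
    (hA : IsSubharmonicFamily Ω A) {B : ConvexBody (EuclideanSpace ℝ (Fin n))}
    {c : EuclideanSpace ℝ (Fin m) → ℝ} {d : EuclideanSpace ℝ (Fin m) → EuclideanSpace ℝ (Fin n)}
    (hc : HarmonicOnNhd c Ω) (hc0 : ∀ x ∈ Ω, 0 ≤ c x)
    (hABd : ∀ x ∈ Ω, (A x : Set (EuclideanSpace ℝ (Fin n))) =
      c x • (B : Set (EuclideanSpace ℝ (Fin n))) + {d x}) : HarmonicOnNhd d Ω := by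
  have hsup : ∀ ξ, ∀ x ∈ Ω, supportFn (A x : Set (EuclideanSpace ℝ (Fin n))) ξ =
      c x * supportFn (B : Set (EuclideanSpace ℝ (Fin n))) ξ + inner ℝ (d x) ξ := by
    intro ξ x hx
    rw [hABd x hx, supportFn_add (B.isCompact.smul _) B.nonempty.smul_set isCompact_singleton
      (singleton_nonempty _), supportFn_smul (hc0 x hx), supportFn_singleton]
  have hdξ : ∀ ξ, ContinuousOn (fun x => inner ℝ (d x) ξ) Ω := by
    intro ξ
    refine ((hA.continuousOn_supportFn ξ).sub (hc.continuousOn.mul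
      (continuousOn_const (c := supportFn (B : Set (EuclideanSpace ℝ (Fin n))) ξ)))).congr ?_
    intro x hx
    have := hsup ξ x hx
    simp only [Pi.sub_apply, Pi.mul_apply]
    linarith
  have hd : ContinuousOn d Ω := by
    have hb : ∀ x, d x = ∑ i, inner ℝ (d x) (EuclideanSpace.basisFun (Fin n) ℝ i) •
        EuclideanSpace.basisFun (Fin n) ℝ i := fun x => by
      conv_lhs => rw [← (EuclideanSpace.basisFun (Fin n) ℝ).sum_repr' (d x)]
      simp_rw [real_inner_comm]
    rw [show d = fun x => ∑ i, inner ℝ (d x) (EuclideanSpace.basisFun (Fin n) ℝ i) •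
        EuclideanSpace.basisFun (Fin n) ℝ i from funext hb]
    exact continuousOn_finsetSum _ fun i _ => (hdξ _).smul continuousOn_const
  refine harmonicOnNhd_of_eq_integral_ballMeasure hΩ hd fun x ε hε hx => ?_
  have hxΩ : x ∈ Ω := hx (Metric.mem_closedBall_self hε.le)
  have hdi := (continuousOn_comp_add_smul hd hε.le hx).integrable_ballMeasure
  have hci := (continuousOn_comp_add_smul hc.continuousOn hε.le hx).integrable_ballMeasure
  set D := ∫ y, d (x + ε • y) ∂ballMeasure (EuclideanSpace ℝ (Fin m)) with hD
  have hge : ∀ ξ, inner ℝ D ξ ≤ inner ℝ (d x) ξ := by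
    intro ξ
    have h := hA.integral_supportFn_le hm hε hx ξ
    rw [hsup ξ x hxΩ] at h
    have h1 : ∫ y, supportFn (A (x + ε • y) : Set (EuclideanSpace ℝ (Fin n))) ξ
        ∂ballMeasure (EuclideanSpace ℝ (Fin m)) =
        ∫ y, (c (x + ε • y) * supportFn (B : Set (EuclideanSpace ℝ (Fin n))) ξ +
          inner ℝ ξ (d (x + ε • y))) ∂ballMeasure (EuclideanSpace ℝ (Fin m)) := by
      refine integral_congr_ae (ae_ballMeasure_norm_lt.mono fun y hy => ?_)
      simp only
      rw [hsup ξ _ (hx (add_smul_mem_closedBall hε.le hy.le)), real_inner_comm]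
    rw [h1, integral_add (hci.mul_const _) (hdi.const_inner ξ), integral_mul_const,
      ← hc.eq_integral_ballMeasure hΩ hε hx, integral_inner hdi, real_inner_comm] at h
    linarith
  -- This direction turns the inequality into ‖d x - D‖² ≤ 0.
  have h := hge (-(d x - D))
  rw [inner_neg_right, inner_neg_right, neg_le_neg_iff, ← sub_nonpos, ← inner_sub_left] at h
  exact sub_eq_zero.1 (inner_self_eq_zero.1 (le_antisymm h real_inner_self_nonneg))

end bodies

/-! ### The characterization. -/

theorem theorem3p1 {m n : ℕ} (hm : 1 ≤ m) (hn : 1 ≤ n)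
    (Ω : Set (EuclideanSpace ℝ (Fin m))) (hΩ_open : IsOpen Ω) (hΩ_conn : IsConnected Ω)
    (A : EuclideanSpace ℝ (Fin m) → ConvexBody (EuclideanSpace ℝ (Fin n)))
    (hA : IsSubharmonicFamily Ω A)
    (hA_vol : ∃ x ∈ Ω, 0 < volume (A x : Set (EuclideanSpace ℝ (Fin n)))) :
    HarmonicOnNhd
        (fun x => volume.real (A x : Set (EuclideanSpace ℝ (Fin n))) ^ ((1 : ℝ) / (n : ℝ))) Ω ↔
      ∃ (B : ConvexBody (EuclideanSpace ℝ (Fin n))) (c : EuclideanSpace ℝ (Fin m) → ℝ)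
        (d : EuclideanSpace ℝ (Fin m) → EuclideanSpace ℝ (Fin n)),
        HarmonicOnNhd c Ω ∧ HarmonicOnNhd d Ω ∧ (∀ x ∈ Ω, 0 < c x) ∧
          ∀ x ∈ Ω, (A x : Set (EuclideanSpace ℝ (Fin n))) =
            c x • (B : Set (EuclideanSpace ℝ (Fin n))) + {d x} := by
  constructor
  · intro hf
    change HarmonicOnNhd (fun x => volumeRoot (A x)) Ω at hf
    obtain ⟨x₀, hx₀, hv⟩ := hA_vol
    have hpos₀ : 0 < volumeRoot (A x₀) :=
      Real.rpow_pos_of_pos (ENNReal.toReal_pos hv.ne' (A x₀).isCompact.measure_ne_top) _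
    have hpos := hf.pos_of_nonneg hΩ_open hΩ_conn.isPreconnected (fun x => volumeRoot_nonneg (A x))
      ⟨x₀, hx₀, hpos₀⟩
    have hhom : ∀ x, ∃ v, x ∈ Ω →
        (volumeRoot (A x))⁻¹ • (A x : Set (EuclideanSpace ℝ (Fin n))) =
          (volumeRoot (A x₀))⁻¹ • (A x₀ : Set (EuclideanSpace ℝ (Fin n))) + {v} := by
      intro x
      by_cases hx : x ∈ Ω
      · obtain ⟨v, hv⟩ := hA.exists_homothety hm hn hΩ_open hΩ_conn.isPreconnected hf hpos hx₀ hx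
        exact ⟨v, fun _ => hv⟩
      · exact ⟨0, fun h => absurd h hx⟩
    choose v hv using hhom
    have hABd : ∀ x ∈ Ω, (A x : Set (EuclideanSpace ℝ (Fin n))) = volumeRoot (A x) •
        (↑((volumeRoot (A x₀))⁻¹ • A x₀) : Set (EuclideanSpace ℝ (Fin n))) +
          {volumeRoot (A x) • v x} := by
      intro x hx
      rw [ConvexBody.coe_smul, ← smul_set_singleton, ← smul_add, ← hv x hx, smul_smul,
        mul_inv_cancel₀ (hpos x hx).ne', one_smul]
    -- Here B is A_{x₀} scaled to volume one, c is the volume root itself, and d is the volume root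
    -- times the shift v.
    exact ⟨_, _, _, hf, hA.harmonicOnNhd_translation hm hΩ_open hf (fun x hx => (hpos x hx).le) hABd,
      hpos, hABd⟩
  · rintro ⟨B, c, d, hc, -, hc0, hABd⟩ x hx
    have heq : ∀ z ∈ Ω, volume.real (A z : Set (EuclideanSpace ℝ (Fin n))) ^ ((1 : ℝ) / (n : ℝ)) =
        (volumeRoot B • c) z := by
      intro z hz
      rw [hABd z hz, real_add_singleton, Pi.smul_apply, smul_eq_mul, mul_comm,
        ← volumeRoot_smul hn (hc0 z hz).le, volumeRoot, ConvexBody.coe_smul]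
    exact (harmonicAt_congr_nhds (Filter.eventually_of_mem (hΩ_open.mem_nhds hx) heq)).2
      ((hc x hx).const_smul)
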